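/- Let $(X,J)=\{(X_n,J_n)\}_{n\ge 0}$ be an upward skip-free Markov additive chain on $\mathbb{Z}\times E$, $E$ finite and nonempty, killed at each step with a constant probability $p^\dagger\in[0,1)$: it is a Markov chain with one-step (unkilled) transition probabilities $\mathbb{P}(X_{n+1}=x+m,\,J_{n+1}=j\mid X_n=x,\,J_n=i)=(\mathbf{A}_m)_{ij}$, where $\mathbf{A}_m=\mathbf{0}$ for $m>1$, the matrix $\mathbf{P}=\sum_{m\le 1}\mathbf{A}_m$ is irreducible, and its row sums all equal $1-p^\dagger$. Assume that $\mathbf{A}_1$ is invertible. Write $\mathbb{E}_x(Y;J_\tau)$ for the matrix with entries $\mathbb{E}(Y;\,\tau<\infty,\,J_\tau=j\mid X_0=x,\,J_0=i)$ (the event includes that the chain is not yet killed at time $\tau$), $\mathbb{P}_x(J_\tau)=\mathbb{E}_x(1;J_\tau)$, and drop the index if $x=0$. Let $\tau^{\{y\}}=\inf\{n\ge 0: X_n=y\}$ and $$\mathbf{F}(z)=\sum_{m\ge -1}z^{m}\mathbf{A}_{-m},\qquad \mathbf{G}=\mathbb{P}\big(J_{\tau^{\{1\}}}\big),\qquad \mathbf{L}_{ij}=\mathbb{E}\Big(\sum_{k\ge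 0}1_{\{X_k=0,\,J_k=j\}}\,\Big|\,X_0=0,\,J_0=i\Big).$$ The scale matrices are, for integers $n\ge 0$ and $z>0$, $$\mathbf{W}(n)=\big[\mathbf{G}^{-n}-\mathbb{P}(J_{\tau^{\{-n\}}})\big]\mathbf{L},\qquad \mathbf{Z}(z,n)=z^{-n}\Big[\mathbf{I}+\sum_{k=0}^{n-1}z^k\,\mathbf{W}(k)\big(\mathbf{I}-\mathbf{F}(z)\big)\Big];$$ if $\mathbf{L}$ has an infinite entry (which requires no killing and zero drift), then $\mathbf{W}(n)$ is given instead by $\mathbf{W}(n)=\mathbf{G}^{-n}\mathbf{L}(n)$, an expression that agrees with the one above when $\mathbf{L}$ is finite; here $\mathbf{L}(n)_{ij}$ is the expected number of visits to $(0,j)$ strictly before $\tau^{\{n\}}$, starting from $(0,i)$. Let $d\ge 1$ be an integer. For $X_0=x\in\{-d,\dots,0\}$ let $H_n=X_n+R^-_n-R^+_n$ be the two-sided reflection of $X$ in the strip $[-d,0]$: $R^-,R^+$ are nondecreasing with $R^-_0=R^+_0=0$, $H_n\in[-d,0]$, and $R^-$ (respectively $R^+$) increases only at times at which $H=-d$ (respectively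 $H=0$). Let $\rho_0=\inf\{n\ge 0:R^+_n>0\}$ and $\mathbf{F}^*(z)=\mathbb{E}_0\big(z^{R^-_{\rho_0}};J_{\rho_0}\big)$. Theorem. For all $z\in(0,1]$ and all integers $x\in[-d,0]$, the matrices $\mathbf{Z}(z,d+1)$ and $\mathbf{I}+\mathbf{W}(d+1)\,[\mathbf{I}-\mathbf{F}(z)]\,\mathbf{Z}(z,d+1)^{-1}$ are invertible, and $$\mathbb{E}_x\big(z^{R^-_{\rho_0}};J_{\rho_0}\big)=\mathbf{Z}(z,d+1+x)\,\mathbf{Z}(z,d+1)^{-1}\,\mathbf{F}^*(z),$$ $$\mathbf{F}^*(z)=z\Big(\mathbf{I}+\mathbf{W}(d+1)\,[\mathbf{I}-\mathbf{F}(z)]\,\mathbf{Z}(z,d+1)^{-1}\Big)^{-1}.$$ -/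

import Mathlib

open MeasureTheory
open scoped ENNReal

/-- The one-step data of an upward skip-free discrete-time Markov additive chain (MAC) `(X, J)` on
`ℤ × E`, with geometric killing. The entry `A m i j` is the one-step probability
`P(X₁ - X₀ = m, J₁ = j, not killed at time 1 | J₀ = i)`; `kill` is the killing probability. -/
structure MACData (E : Type*) [Fintype E] where
  A : ℤ → Matrix E E ℝ
  kill : ℝ
  nonneg : ∀ m i j, 0 ≤ A m i j
  skipFree : ∀ m, 1 < m → A m = 0
  summable : ∀ i j, Summable fun m => A m i j
  kill_nonneg : 0 ≤ kill
  kill_lt_one : kill < 1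
  rowSum : ∀ i, ∑ j, ∑' m, A m i j = 1 - kill
  irreducible : Matrix.IsIrreducible (Matrix.of fun i j => ∑' m, A m i j)

namespace MACData

variable {E : Type*} [Fintype E]

/-- One-step transition probabilities on `(ℤ × E) ∪ {†}`, where `none` is the cemetery state. -/
def step (M : MACData E) : Option (ℤ × E) → Option (ℤ × E) → ℝ
  | some a, some b => M.A (b.1 - a.1) a.2 b.2
  | some _, none => M.kill
  | none, some _ => 0
  | none, none => 1

/-- `S` is, under the probability measures `ℙ a` (`a = (x, i)` is the starting point), a Markov
chain with transition probabilities `M.step`, i.e. a MAC with one-step data `M`. -/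
structure IsMAC (M : MACData E) {Ω : Type*} [MeasurableSpace Ω]
    (S : ℕ → Ω → Option (ℤ × E)) (ℙ : ℤ × E → Measure Ω) : Prop where
  measurable : ∀ n s, MeasurableSet {ω | S n ω = s}
  prob : ∀ a, IsProbabilityMeasure (ℙ a)
  law : ∀ (a : ℤ × E) (n : ℕ) (s : ℕ → Option (ℤ × E)), s 0 = some a →
    ℙ a {ω | ∀ k ≤ n, S k ω = s k} =
      ENNReal.ofReal (∏ k ∈ Finset.range n, M.step (s k) (s (k + 1)))

/-- The matrix `F(z) = E(z^{-X₁}; J₁) = ∑_{m ≥ -1} z^m A_{-m}`. -/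
noncomputable def F (M : MACData E) (z : ℝ) : Matrix E E ℝ :=
  Matrix.of fun i j => ∑' m : ℤ, z ^ (-m) * M.A m i j

end MACData

namespace MAC

/-- The first time at which `p` holds, `⊤` if there is none. -/
noncomputable def firstTime (p : ℕ → Prop) : ℕ∞ := ⨅ (n : ℕ) (_ : p n), (n : ℕ∞)

section Reflection

/-! Two-sided reflection in the strip `[-d, 0]` of an integer sequence `ξ` with `ξ 0 ∈ [-d, 0]`. -/

/-- The reflected sequence `H`. -/
def reflected (d : ℕ) (ξ : ℕ → ℤ) : ℕ → ℤ
  | 0 => ξ 0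
  | n + 1 => max (-(d : ℤ)) (min 0 (reflected d ξ n + (ξ (n + 1) - ξ n)))

/-- The regulator `R⁻` at the lower barrier `-d`. -/
def lowerReg (d : ℕ) (ξ : ℕ → ℤ) : ℕ → ℤ
  | 0 => 0
  | n + 1 => lowerReg d ξ n + max 0 (-(d : ℤ) - (reflected d ξ n + (ξ (n + 1) - ξ n)))

/-- The regulator `R⁺` at the upper barrier `0`. -/
def upperReg (d : ℕ) (ξ : ℕ → ℤ) : ℕ → ℤ
  | 0 => 0
  | n + 1 => upperReg d ξ n + max 0 (reflected d ξ n + (ξ (n + 1) - ξ n))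

/-- The three sequences solve the discrete Skorokhod problem: `H = ξ + R⁻ - R⁺` stays in `[-d, 0]`,
and the nondecreasing regulators increase only at times when `H = -d`, respectively `H = 0`. -/
theorem reflection_spec (d : ℕ) (ξ : ℕ → ℤ) (h : ξ 0 ∈ Set.Icc (-(d : ℤ)) 0) (n : ℕ) :
    reflected d ξ n = ξ n + lowerReg d ξ n - upperReg d ξ n ∧
    reflected d ξ n ∈ Set.Icc (-(d : ℤ)) 0 ∧
    lowerReg d ξ n ≤ lowerReg d ξ (n + 1) ∧ upperReg d ξ n ≤ upperReg d ξ (n + 1) ∧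
    (lowerReg d ξ n < lowerReg d ξ (n + 1) → reflected d ξ (n + 1) = -(d : ℤ)) ∧
    (upperReg d ξ n < upperReg d ξ (n + 1) → reflected d ξ (n + 1) = 0) := by
  simp only [Set.mem_Icc] at *
  induction n with
  | zero => simp only [reflected, lowerReg, upperReg]; omega
  | succ n ih => simp only [reflected, lowerReg, upperReg] at *; omega

end Reflection

section Chain

variable {E : Type*}

/-- The level of a state (the value at the cemetery state is irrelevant: every quantity below is
evaluated at a time at which the chain is alive). -/
def level : Option (ℤ × E) → ℤ
  | some a => a.1
  | none => 0

variable {Ω : Type*} (S : ℕ → Ω → Option (ℤ × E))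

/-- The hitting time `τ^{y}` of the level `y`. -/
noncomputable def hitTime (y : ℤ) (ω : Ω) : ℕ∞ :=
  firstTime fun n => (S n ω).map Prod.fst = some y

/-- The time `ρ₀` of the first increase of the upper regulator. -/
noncomputable def rho (d : ℕ) (ω : Ω) : ℕ∞ :=
  firstTime fun n => 0 < upperReg d (fun k => level (S k ω)) n

variable [MeasurableSpace Ω] (ℙ : ℤ × E → Measure Ω)

/-- The matrix `P(J_{τ^{y}})`, with entries `P(τ^{y} < ∞, J_{τ^{y}} = j | X₀ = 0, J₀ = i)`. -/
noncomputable def hitMatrix (y : ℤ) : Matrix E E ℝ :=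
  Matrix.of fun i j => (ℙ (0, i)).real
    {ω | hitTime S y ω ≠ ⊤ ∧ S (hitTime S y ω).toNat ω = some (y, j)}

/-- The fundamental matrix `G = P(J_{τ^{1}})`. -/
noncomputable def G : Matrix E E ℝ := hitMatrix S ℙ 1

/-- The expected number of visits to the state `(0, j)` over an infinite time horizon, from
`(0, i)`. -/
noncomputable def occ (i j : E) : ℝ≥0∞ :=
  ∫⁻ ω, ∑' k : ℕ, {ω | S k ω = some (0, j)}.indicator 1 ω ∂ℙ (0, i)

/-- The infinite-time occupation mass matrix `L` at the level `0`. -/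
noncomputable def L : Matrix E E ℝ := Matrix.of fun i j => (occ S ℙ i j).toReal

/-- The matrix `L(n)` of expected numbers of visits to the states `(0, j)` before the level `n` is
hit, from `(0, i)`. -/
noncomputable def LBefore (n : ℕ) : Matrix E E ℝ :=
  Matrix.of fun i j => (∫⁻ ω, ∑' k : ℕ,
    {ω | S k ω = some (0, j) ∧ (k : ℕ∞) < hitTime S n ω}.indicator 1 ω ∂ℙ (0, i)).toReal

variable [Fintype E] [DecidableEq E]

open Classical in
/-- The scale matrix `W(n) = (G⁻ⁿ - P(J_{τ^{-n}})) L`. If `L` has an infinite entry (no killing and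
zero drift) this expression is meaningless, and `W(n)` is given by its extension `G⁻ⁿ L(n)`. -/
noncomputable def W (n : ℕ) : Matrix E E ℝ :=
  if ∀ i j, occ S ℙ i j ≠ ⊤ then ((G S ℙ)⁻¹ ^ n - hitMatrix S ℙ (-(n : ℤ))) * L S ℙ
  else (G S ℙ)⁻¹ ^ n * LBefore S ℙ n

/-- The second scale matrix `Z(z, n) = z⁻ⁿ (I + ∑_{k=0}^{n-1} z^k W(k) (I - F(z)))`. -/
noncomputable def Z (M : MACData E) (z : ℝ) (n : ℕ) : Matrix E E ℝ :=
  (z⁻¹ ^ n) • (1 + ∑ k ∈ Finset.range n, z ^ k • (W S ℙ k * (1 - M.F z)))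

/-- The transform `E_x(z^{R⁻_{ρ₀}}; J_{ρ₀})`, with `(i, j)` entry
`E(z^{R⁻_{ρ₀}}; ρ₀ < ∞, J_{ρ₀} = j | X₀ = x, J₀ = i)`. -/
noncomputable def lowerRegTransform (d : ℕ) (z : ℝ) (x : ℤ) : Matrix E E ℝ :=
  Matrix.of fun i j =>
    ∫ ω in {ω | rho S d ω ≠ ⊤ ∧ (S (rho S d ω).toNat ω).map Prod.snd = some j},
      z ^ lowerReg d (fun k => level (S k ω)) (rho S d ω).toNat ∂ℙ (x, i)

end Chain

end MAC

/-! The transform u(x) = E_x(z^{R⁻_{ρ₀}}; J_{ρ₀}) solves a Dirichlet problem. Put u(1) = I and u(y)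
= z^{-d-y} u(-d) for y ≤ -d; conditioning on the first step gives ∑ A_m u(x+m) = u(x) on [-d, 0]
(`exitTotal_eq`). Solutions are determined by their value at level 1 (`eq_zero_of_harmonic`). This
is a maximum principle: the invertible matrix A_1 has positive row sums, so level 1 is reached from
the strip in at most d+1 upward steps with positive probability.

A solution is x ↦ Z(z, d+1+x). Since W(n) = 0 for n ≤ 0, Z(z, n) = z^{-n} I for n ≤ 1, which is the
reflection condition, and Z is harmonic at every n ≥ 1 (`hasSum_scaleZ`). If Z(z, d+2) B = 0,
uniqueness makes Z(z, d+1+x) B vanish on the strip; at x = -d it is z^{-1} B, so B = 0. Hence Z(z,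
d+2) is invertible and u(x) = Z(z, d+1+x) Z(z, d+2)^{-1}. The recursion `scaleZ_succ` expresses Z(z,
d+2) through Z(z, d+1) and W(d+1); the stated formulas are then algebra.

Harmonicity of Z comes from ∑ A_m W(x+m) = W(x) + 1_{x=0} I (`hasSum_scaleW`). For x ≤ N,
`scaleW_eq` writes W(x) = G^{N-x} W(N) - V_N(x), where V_N(x) counts expected visits to 0 before N.
The first term is harmonic because G = ∑ A_m G^{1-m}; the second has a unit source at 0. The
representation is a first passage decomposition: an upward skip-free path meets every level it
climbs over. V_N is always finite (`visits_ne_top`), so finite and infinite L are treated together.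
-/

namespace MACData

variable {E : Type*} [Fintype E]

/-! ### The transition operator on [0, ∞]-valued matrix functions -/

/-- The action `f ↦ (x ↦ ∑ₘ Aₘ f(x + m))` of the transition kernel on functions of the level. -/
noncomputable def transfer (M : MACData E) (f : ℤ → Matrix E E ℝ≥0∞) (x : ℤ) :
    Matrix E E ℝ≥0∞ :=
  Matrix.of fun i j => ∑' m : ℤ, ∑ k, ENNReal.ofReal (M.A m i k) * f (x + m) k j

theorem transfer_congr (M : MACData E) {f g : ℤ → Matrix E E ℝ≥0∞} {x : ℤ}
    (h : ∀ m ≤ 1, f (x + m) = g (x + m)) : M.transfer f x = M.transfer g x := by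
  ext i j
  refine tsum_congr fun m => ?_
  by_cases hm : m ≤ 1
  · rw [h m hm]
  · simp [M.skipFree m (not_le.1 hm)]

theorem transfer_shift (M : MACData E) (f : ℤ → Matrix E E ℝ≥0∞) (x y : ℤ) :
    M.transfer (fun w => f (w + y)) x = M.transfer f (x + y) := by
  ext i j
  refine tsum_congr fun m => ?_
  simp only [add_right_comm]

theorem transfer_add (M : MACData E) (f g : ℤ → Matrix E E ℝ≥0∞) (x : ℤ) :
    M.transfer (fun y => f y + g y) x = M.transfer f x + M.transfer g x := by
  ext i j
  simp only [transfer, Matrix.of_apply, Matrix.add_apply, mul_add, Finset.sum_add_distrib]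
  exact ENNReal.tsum_add

theorem transfer_mul (M : MACData E) (f : ℤ → Matrix E E ℝ≥0∞) (c : Matrix E E ℝ≥0∞) (x : ℤ) :
    M.transfer (fun y => f y * c) x = M.transfer f x * c := by
  ext i j
  simp only [transfer, Matrix.of_apply, Matrix.mul_apply, ← ENNReal.tsum_mul_right]
  rw [← Summable.tsum_finsetSum fun _ _ => ENNReal.summable]
  refine tsum_congr fun m => ?_
  simp only [Finset.mul_sum, Finset.sum_mul, mul_assoc]
  exact Finset.sum_comm

theorem transfer_sum (M : MACData E) {ι : Type*} (s : Finset ι)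
    (f : ι → ℤ → Matrix E E ℝ≥0∞) (x : ℤ) :
    M.transfer (fun y => ∑ b ∈ s, f b y) x = ∑ b ∈ s, M.transfer (f b) x := by
  classical
  induction s using Finset.induction_on with
  | empty => ext i j; simp [transfer]
  | insert b s hb ih => simp only [Finset.sum_insert hb, transfer_add, ih]

theorem transfer_tsum (M : MACData E) (f : ℕ → ℤ → Matrix E E ℝ≥0∞) (x : ℤ) (i j : E) :
    M.transfer (fun y => Matrix.of fun i j => ∑' n, f n y i j) x i j =
      ∑' n, M.transfer (f n) x i j := by
  simp only [transfer, Matrix.of_apply, ← ENNReal.tsum_mul_left]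
  rw [ENNReal.tsum_comm]
  refine tsum_congr fun m => ?_
  rw [Summable.tsum_finsetSum fun _ _ => ENNReal.summable]

theorem transfer_mono (M : MACData E) {f g : ℤ → Matrix E E ℝ≥0∞} {x : ℤ} {i j : E}
    (h : ∀ m ≤ 1, ∀ k, f (x + m) k j ≤ g (x + m) k j) :
    M.transfer f x i j ≤ M.transfer g x i j := by
  refine ENNReal.tsum_le_tsum fun m => Finset.sum_le_sum fun k _ => ?_
  by_cases hm : m ≤ 1
  · gcongr; exact h m hm k
  · simp [M.skipFree m (not_le.1 hm)]

theorem tsum_ofReal_A (M : MACData E) (i : E) :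
    ∑' m : ℤ, ∑ k, ENNReal.ofReal (M.A m i k) = ENNReal.ofReal (1 - M.kill) := by
  rw [Summable.tsum_finsetSum fun _ _ => ENNReal.summable, ← M.rowSum i,
    ENNReal.ofReal_sum_of_nonneg fun j _ => tsum_nonneg fun m => M.nonneg m i j]
  exact Finset.sum_congr rfl fun j _ =>
    (ENNReal.ofReal_tsum_of_nonneg (fun m => M.nonneg m i j) (M.summable i j)).symm

theorem transfer_const_le (M : MACData E) (c : ℝ≥0∞) (x : ℤ) (i j : E) :
    M.transfer (fun _ => Matrix.of fun _ _ => c) x i j ≤ c := by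
  simp only [transfer, Matrix.of_apply, ← Finset.sum_mul, ENNReal.tsum_mul_right,
    M.tsum_ofReal_A]
  refine mul_le_of_le_one_left' ?_
  rw [ENNReal.ofReal_le_one]
  linarith [M.kill_nonneg]

variable [DecidableEq E]

/-! ### Stopped chains and first passage decompositions -/

open Classical in
/-- `stopped B C n x` is the matrix of the probabilities that the chain started at level `x` has
its level in `C` at time `n` and outside `B` at all earlier times. -/
noncomputable def stopped (M : MACData E) (B C : Set ℤ) : ℕ → ℤ → Matrix E E ℝ≥0∞
  | 0, x => if x ∈ C then 1 else 0
  | n + 1, x => if x ∈ B then 0 else M.transfer (M.stopped B C n) x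

theorem stopped_hit_self (M : MACData E) (n : ℕ) :
    M.stopped {0} {0} n 0 = if n = 0 then 1 else 0 := by
  cases n <;> simp [stopped]

/-- First passage decomposition at the level `N`. -/
theorem firstPassage (M : MACData E) {D : Set ℤ} {N : ℤ}
    (hD : ∀ x ∈ D, ∀ m ≤ 1, x + m ∈ D ∨ x + m = N) (hN : N ∉ D)
    {f e : ℕ → ℤ → Matrix E E ℝ≥0∞} (h0 : ∀ x ∈ D, f 0 x = e 0 x)
    (hf : ∀ n, ∀ x ∈ D, f (n + 1) x = M.transfer (f n) x)
    (he : ∀ n, ∀ x ∈ D, e (n + 1) x = M.transfer (e n) x) (heN : ∀ n, e n N = 0)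
    (n : ℕ) (x : ℤ) (hx : x ∈ D ∨ x = N) :
    f n x = e n x +
      ∑ p ∈ Finset.HasAntidiagonal.antidiagonal n, M.stopped {0} {0} p.1 (x - N) * f p.2 N := by
  induction n generalizing x with
  | zero =>
    rcases hx with hx | rfl
    · have : x - N ≠ 0 := sub_ne_zero.2 fun h => hN (h ▸ hx)
      simp [h0 x hx, stopped, this]
    · simp [heN, stopped]
  | succ n ih =>
    rcases hx with hx | rfl
    · have hne : x - N ≠ 0 := sub_ne_zero.2 fun h => hN (h ▸ hx)
      rw [hf n x hx, he n x hx, Finset.Nat.antidiagonal_succ, Finset.sum_cons, Finset.sum_map,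
        M.transfer_congr (g := fun y => e n y + ∑ p ∈ Finset.HasAntidiagonal.antidiagonal n,
          M.stopped {0} {0} p.1 (y - N) * f p.2 N) fun m hm => ih (x + m) (hD x hx m hm),
        transfer_add, transfer_sum]
      congr 1
      -- Passage from x ≠ N takes at least one step, so the term with passage time 0 drops out and
      -- the others are one step of the induction hypothesis.
      have h1 : M.stopped {0} {0} 0 (x - N) = 0 := by simp [stopped, hne]
      simp only [h1, zero_mul, zero_add]
      refine Finset.sum_congr rfl fun p _ => ?_
      rw [transfer_mul]
      simp only [sub_eq_add_neg, transfer_shift M (M.stopped {0} {0} p.1)] at hne ⊢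
      simp [stopped, hne]
    -- Started at N, the passage time is 0 and only one term of the convolution survives.
    · rw [heN, zero_add, sub_self, Finset.Nat.antidiagonal_succ, Finset.sum_cons, Finset.sum_map]
      simp [stopped_hit_self]

/-- The expected number of times at which the level is in `C`, up to the first time at which it is
in `B`. -/
noncomputable def green (M : MACData E) (B C : Set ℤ) (x : ℤ) : Matrix E E ℝ≥0∞ :=
  Matrix.of fun i j => ∑' n, M.stopped B C n x i j

open Classical in
theorem green_eq (M : MACData E) (B C : Set ℤ) (x : ℤ) :
    M.green B C x =
      (if x ∈ C then 1 else 0) + if x ∈ B then 0 else M.transfer (M.green B C) x := by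
  ext i j
  simp only [green, Matrix.of_apply, Matrix.add_apply]
  rw [tsum_eq_zero_add' ENNReal.summable]
  congr 1
  by_cases hx : x ∈ B
  · simp [stopped, hx]
  · simp only [stopped, hx, if_false]
    exact (M.transfer_tsum _ x i j).symm

theorem tsum_antidiagonal_mul (f g : ℕ → ℝ≥0∞) :
    ∑' n, ∑ p ∈ Finset.HasAntidiagonal.antidiagonal n, f p.1 * g p.2 = (∑' n, f n) * ∑' n, g n := by
  rw [← ENNReal.tsum_mul_right]
  simp only [← ENNReal.tsum_mul_left]
  rw [← ENNReal.tsum_prod' (f := fun p : ℕ × ℕ => f p.1 * g p.2),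
    ← Finset.HasAntidiagonal.sigmaAntidiagonalEquivProd.tsum_eq, ENNReal.tsum_sigma']
  refine tsum_congr fun n => ?_
  rw [tsum_fintype, ← Finset.sum_coe_sort]
  rfl

/-- Summing over time turns the convolution in `firstPassage` into a product; in [0, ∞] this needs
no convergence hypothesis. -/
theorem tsum_firstPassage (M : MACData E) {D : Set ℤ} {N : ℤ}
    (hD : ∀ x ∈ D, ∀ m ≤ 1, x + m ∈ D ∨ x + m = N) (hN : N ∉ D)
    {f e : ℕ → ℤ → Matrix E E ℝ≥0∞} (h0 : ∀ x ∈ D, f 0 x = e 0 x)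
    (hf : ∀ n, ∀ x ∈ D, f (n + 1) x = M.transfer (f n) x)
    (he : ∀ n, ∀ x ∈ D, e (n + 1) x = M.transfer (e n) x) (heN : ∀ n, e n N = 0)
    (x : ℤ) (hx : x ∈ D ∨ x = N) :
    (Matrix.of fun i j => ∑' n, f n x i j) = (Matrix.of fun i j => ∑' n, e n x i j) +
      M.green {0} {0} (x - N) * Matrix.of fun i j => ∑' n, f n N i j := by
  ext i j
  simp only [green, Matrix.of_apply, Matrix.add_apply, Matrix.mul_apply]
  simp only [← tsum_antidiagonal_mul]
  rw [← Summable.tsum_finsetSum fun _ _ => ENNReal.summable, ← ENNReal.tsum_add]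
  refine tsum_congr fun n => ?_
  rw [M.firstPassage hD hN h0 hf he heN n x hx]
  simp only [Matrix.add_apply, Matrix.sum_apply, Matrix.mul_apply]
  rw [Finset.sum_comm]

theorem green_hit_self (M : MACData E) : M.green {0} {0} 0 = 1 := by
  simp [green_eq]

/-- A path rising from x to 0 must first pass through -1. Iterated, this makes upward passage
matrices powers of G. -/
theorem green_hit_succ (M : MACData E) (x : ℤ) (hx : x ≤ -1) :
    M.green {0} {0} x = M.green {0} {0} (x + 1) * M.green {0} {0} (-1) := by
  have h := M.tsum_firstPassage (D := Set.Iio (-1)) (N := -1) (f := M.stopped {0} {0})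
    (e := fun _ _ => 0) (fun y hy m hm => by simp only [Set.mem_Iio] at *; omega) (by simp)
    (fun y hy => by
      have : y ≠ 0 := by simp only [Set.mem_Iio] at hy; omega
      simp [stopped, this])
    (fun n y hy => by
      have : y ≠ 0 := by simp only [Set.mem_Iio] at hy; omega
      simp [stopped, this])
    (fun n y hy => by ext; simp [transfer]) (fun _ => rfl) x
    (by simp only [Set.mem_Iio]; omega)
  rw [sub_neg_eq_add] at h
  refine h.trans ?_
  have h0 : (Matrix.of fun i j => ∑' n : ℕ, (0 : Matrix E E ℝ≥0∞) i j) = 0 := by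
    ext i j
    simp
  rw [h0, zero_add]
  rfl

theorem green_eq_hit_mul (M : MACData E) (x : ℤ) :
    M.green ∅ {0} x = M.green {0} {0} x * M.green ∅ {0} 0 := by
  have h := M.tsum_firstPassage (D := {0}ᶜ) (N := 0) (f := M.stopped ∅ {0})
    (e := fun _ _ => 0) (fun y hy m hm => by simp only [Set.mem_compl_iff, Set.mem_singleton_iff]; omega)
    (by simp) (fun y hy => by
      have : y ≠ 0 := hy
      simp [stopped, this])
    (fun n y hy => by simp [stopped])
    (fun n y hy => by ext; simp [transfer]) (fun _ => rfl) x
    (by simp only [Set.mem_compl_iff, Set.mem_singleton_iff]; omega)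
  rw [sub_zero] at h
  refine h.trans ?_
  have h0 : (Matrix.of fun i j => ∑' n : ℕ, (0 : Matrix E E ℝ≥0∞) i j) = 0 := by
    ext i j
    simp
  rw [h0, zero_add]
  rfl

/-! ### Visits to level 0 before a level is hit, and their finiteness -/

/-- The expected number of visits to the level `0` before the first visit to `B`. -/
noncomputable def visits (M : MACData E) (B : Set ℤ) (x : ℤ) : Matrix E E ℝ≥0∞ :=
  M.green B ({0} \ B) x

theorem visits_eq_zero (M : MACData E) {B : Set ℤ} {x : ℤ} (hx : x ∈ B) :
    M.visits B x = 0 := by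
  rw [visits, green_eq]
  simp [hx]

theorem visits_eq (M : MACData E) {B : Set ℤ} {x : ℤ} (hx : x ∉ B) :
    M.visits B x = (if x = 0 then 1 else 0) + M.transfer (M.visits B) x := by
  rw [visits, green_eq]
  simp [hx]
  rfl

/-- From x ≤ N the set B cannot be met before N, so the visits split at the first passage through N.
With B = ∅ this relates L(N) to L; with a singleton it relates the counts for two target levels. -/
theorem visits_eq_add (M : MACData E) {B : Set ℤ} {N x : ℤ} (hB : ∀ y ∈ B, N ≤ y) (hx : x ≤ N) :
    M.visits B x = M.visits {N} x + M.green {0} {0} (x - N) * M.visits B N := by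
  refine M.tsum_firstPassage (D := Set.Iio N) (N := N) (f := M.stopped B ({0} \ B))
    (e := M.stopped {N} ({0} \ {N}))
    (fun y hy m hm => by simp only [Set.mem_Iio] at *; omega) (by simp)
    (fun y hy => ?_) (fun n y hy => ?_) (fun n y hy => ?_) (fun n => ?_) x
    (by simp only [Set.mem_Iio]; omega)
  · have h1 : y ∉ B := fun h => (hB y h).not_gt hy
    have h2 : y ≠ N := ne_of_lt hy
    simp [stopped, h1, h2]
  · have h1 : y ∉ B := fun h => (hB y h).not_gt hy
    simp [stopped, h1]
  · have h2 : y ≠ N := ne_of_lt hy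
    simp [stopped, h2]
  · cases n <;> simp [stopped]

theorem visits_zero_eq_zero (M : MACData E) {x : ℤ} : M.visits {0} x = 0 := by
  have : ∀ n y, M.stopped {0} ({0} \ {0}) n y = 0 := by
    intro n
    induction n with
    | zero => simp [stopped]
    | succ n ih =>
      intro y
      have : M.transfer (M.stopped {0} ({0} \ {0}) n) y = 0 := by
        ext i j
        simp only [transfer, ih]
        simp
      simp only [stopped, this, ite_self]
  ext i j
  simp only [visits, green, this]
  simp

/-- A function dominating the increasing part of a Lyapunov function for the visits to `0`. -/
noncomputable def lyapunov (K : ℝ≥0∞) (x : ℤ) : ℝ≥0∞ := if x ≤ 0 then 0 else K ^ x.toNat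

-- A single upward step, of probability at least α = 1/K, already suffices: α K^{x+1} = K^x for x ≥
-- 0. At x = 0 this covers the unit cost of a visit, because `lyapunov` is 0 there rather than 1.
omit [DecidableEq E] in
theorem one_add_lyapunov_le (M : MACData E) {α K : ℝ≥0∞} (hαK : α * K = 1)
    (hα : ∀ i, α ≤ ∑ k, ENNReal.ofReal (M.A 1 i k)) (x : ℤ) (i j : E) :
    (if x = 0 then 1 else 0) + lyapunov K x ≤
      M.transfer (fun y => Matrix.of fun _ _ => lyapunov K y) x i j := by
  have h1 : α * lyapunov K (x + 1) ≤
      M.transfer (fun y => Matrix.of fun _ _ => lyapunov K y) x i j := by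
    refine le_trans ?_ (ENNReal.le_tsum 1)
    simp only [Matrix.of_apply, ← Finset.sum_mul]
    gcongr
    exact hα i
  refine le_trans ?_ h1
  rcases lt_trichotomy x 0 with hx | rfl | hx
  · simp [lyapunov, hx.ne, hx.le]
  · simp [lyapunov, hαK]
  · have h2 : (x + 1).toNat = x.toNat + 1 := by omega
    have h3 : ¬ x ≤ 0 := by omega
    have h4 : ¬ x + 1 ≤ 0 := by omega
    simp only [lyapunov, hx.ne', h3, h4, if_false, h2, pow_succ', ← mul_assoc, hαK]
    simp

/-- Each visit to 0 is paid for by an expected increase of the Lyapunov function, which is at most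
K^N up to level N. The bound is uniform in the number of steps n. -/
theorem sum_stopped_add_lyapunov_le (M : MACData E) {α K : ℝ≥0∞} (hαK : α * K = 1) (hK : 1 ≤ K)
    (hα : ∀ i, α ≤ ∑ k, ENNReal.ofReal (M.A 1 i k)) (N : ℕ) (n : ℕ) (x : ℤ) (hx : x ≤ N)
    (i j : E) :
    ∑ k ∈ Finset.range n, M.stopped {(N : ℤ)} ({0} \ {(N : ℤ)}) k x i j + lyapunov K x ≤
      K ^ N := by
  have hl : lyapunov K x ≤ K ^ N := by
    unfold lyapunov
    split_ifs
    · simp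
    · exact pow_le_pow_right₀ hK (by omega)
  induction n generalizing x i with
  | zero => simpa using hl
  | succ n ih =>
    rw [Finset.sum_range_succ']
    by_cases hxN : x = N
    · subst hxN
      simpa [stopped] using hl
    have h0 : M.stopped {(N : ℤ)} ({0} \ {(N : ℤ)}) 0 x i j ≤ if x = 0 then 1 else 0 := by
      by_cases h : x = 0
      · subst h
        simp only [stopped, Set.mem_sdiff, Set.mem_singleton_iff, hxN, not_false_eq_true, and_self,
          if_true, Matrix.one_apply]
        split_ifs <;> simp
      · simp [stopped, h]
    rw [add_assoc]
    refine (add_le_add_right ((add_le_add_left h0 _).trans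
      (M.one_add_lyapunov_le hαK hα x i j)) _).trans ?_
    have h1 : ∀ k, M.stopped {(N : ℤ)} ({0} \ {(N : ℤ)}) (k + 1) x =
        M.transfer (M.stopped {(N : ℤ)} ({0} \ {(N : ℤ)}) k) x := fun k => by
      simp [stopped, hxN]
    simp only [h1]
    rw [← Matrix.sum_apply, ← transfer_sum, ← Matrix.add_apply, ← transfer_add]
    refine (M.transfer_mono fun m hm k => ?_).trans (M.transfer_const_le (K ^ N) x i j)
    simp only [Matrix.add_apply, Matrix.sum_apply, Matrix.of_apply]
    have hxm : x + m ≤ N := by omega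
    refine ih (x + m) hxm k ?_
    unfold lyapunov
    split_ifs
    · simp
    · exact pow_le_pow_right₀ hK (by omega)

/-- A row of the nonnegative matrix A_1 with zero sum would vanish, and so would the determinant. -/
theorem exists_le_sum_A_one (M : MACData E) (hA : IsUnit (M.A 1)) :
    ∃ α : ℝ, 0 < α ∧ α ≤ 1 ∧ ∀ i, α ≤ ∑ k, M.A 1 i k := by
  have hpos : ∀ i, 0 < ∑ k, M.A 1 i k := by
    intro i
    refine (Finset.sum_nonneg fun k _ => M.nonneg 1 i k).lt_of_ne fun h => ?_
    have hz := (Finset.sum_eq_zero_iff_of_nonneg fun k _ => M.nonneg 1 i k).1 h.symm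
    have hdet := (Matrix.isUnit_iff_isUnit_det _).1 hA
    rw [Matrix.det_eq_zero_of_row_eq_zero i fun k => hz k (Finset.mem_univ k)] at hdet
    exact not_isUnit_zero hdet
  obtain hE | hE := isEmpty_or_nonempty E
  · exact ⟨1, one_pos, le_rfl, fun i => isEmptyElim i⟩
  obtain ⟨i₀, -, h⟩ := Finset.exists_min_image Finset.univ (fun i => ∑ k, M.A 1 i k)
    Finset.univ_nonempty
  exact ⟨min 1 (∑ k, M.A 1 i₀ k), lt_min one_pos (hpos i₀), min_le_left _ _,
    fun i => (min_le_right _ _).trans (h i (Finset.mem_univ i))⟩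

theorem visits_ne_top (M : MACData E) (hA : IsUnit (M.A 1)) (N : ℕ) {x : ℤ} (hx : x ≤ N)
    (i j : E) : M.visits {(N : ℤ)} x i j ≠ ⊤ := by
  obtain ⟨α, h0, h1, hα⟩ := M.exists_le_sum_A_one hA
  have hα0 : ENNReal.ofReal α ≠ 0 := by simpa using h0
  have hK : (1 : ℝ≥0∞) ≤ (ENNReal.ofReal α)⁻¹ := by simpa using h1
  refine ne_top_of_le_ne_top (ENNReal.pow_ne_top (n := N) (ENNReal.inv_ne_top.2 hα0))
    (ENNReal.tsum_le_of_sum_range_le fun n => le_self_add.trans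
      (M.sum_stopped_add_lyapunov_le (ENNReal.mul_inv_cancel hα0 ENNReal.ofReal_ne_top) hK
        (fun i => ?_) N n x hx i j))
  rw [← ENNReal.ofReal_sum_of_nonneg fun k _ => M.nonneg 1 i k]
  exact ENNReal.ofReal_le_ofReal (hα i)

end MACData

/-! ### Path space: first times, cylinders, measurability -/

namespace MAC

/-- The discrete σ-algebra on the state space of a Markov additive chain. -/
instance instMeasurableSpaceState {E : Type*} : MeasurableSpace (Option (ℤ × E)) := ⊤

instance instDiscreteMeasurableSpaceState {E : Type*} :
    DiscreteMeasurableSpace (Option (ℤ × E)) := ⟨fun _ => trivial⟩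

variable {E : Type*}

theorem firstTime_eq_coe {p : ℕ → Prop} {n : ℕ} :
    firstTime p = n ↔ p n ∧ ∀ k < n, ¬ p k := by
  constructor
  · intro h
    have hlt : ∀ k < n, ¬ p k := fun k hk hp => by
      have : firstTime p ≤ k := iInf₂_le k hp
      rw [h] at this
      exact absurd (by exact_mod_cast this) (not_le.2 hk)
    refine ⟨?_, hlt⟩
    by_contra hn
    have : ((n + 1 : ℕ) : ℕ∞) ≤ firstTime p := by
      refine le_iInf₂ fun k hk => ?_
      have : n + 1 ≤ k := by
        by_contra hk'
        rcases (Nat.lt_succ_iff_lt_or_eq.1 (not_le.1 hk')) with h1 | rfl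
        · exact hlt k h1 hk
        · exact hn hk
      exact_mod_cast this
    rw [h] at this
    have : n + 1 ≤ n := by exact_mod_cast this
    omega
  · rintro ⟨hp, h⟩
    refine le_antisymm (iInf₂_le n hp) (le_iInf₂ fun k hk => ?_)
    have : n ≤ k := by
      by_contra hk'
      exact h k (not_le.1 hk') hk
    exact_mod_cast this

theorem coe_lt_firstTime {p : ℕ → Prop} {n : ℕ} : (n : ℕ∞) < firstTime p ↔ ∀ k ≤ n, ¬ p k := by
  constructor
  · intro h k hk hp
    have h1 : firstTime p ≤ k := iInf₂_le k hp
    have h2 : (n : ℕ∞) < k := h.trans_le h1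
    have : n < k := by exact_mod_cast h2
    omega
  · intro h
    have : ((n + 1 : ℕ) : ℕ∞) ≤ firstTime p := by
      refine le_iInf₂ fun k hk => ?_
      have : n + 1 ≤ k := by
        by_contra hk'
        exact h k (by omega) hk
      exact_mod_cast this
    refine lt_of_lt_of_le ?_ this
    exact_mod_cast Nat.lt_succ_self n

/-- Prepend a state to a path. -/
def cons (a : Option (ℤ × E)) (p : ℕ → Option (ℤ × E)) : ℕ → Option (ℤ × E)
  | 0 => a
  | n + 1 => p n

@[simp] theorem cons_zero (a : Option (ℤ × E)) (p : ℕ → Option (ℤ × E)) : cons a p 0 = a := rfl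

@[simp] theorem cons_succ (a : Option (ℤ × E)) (p : ℕ → Option (ℤ × E)) (n : ℕ) :
    cons a p (n + 1) = p n := rfl

theorem cons_tail (p : ℕ → Option (ℤ × E)) : cons (p 0) (fun n => p (n + 1)) = p := by
  ext1 n
  cases n <;> rfl

theorem measurable_cons (a : Option (ℤ × E)) : Measurable (cons a) := by
  refine measurable_pi_iff.2 fun n => ?_
  cases n with
  | zero => exact measurable_const
  | succ n => exact measurable_pi_apply n

/-- The set of the paths that agree with `s` up to time `n`. -/
def cylinder (n : ℕ) (s : ℕ → Option (ℤ × E)) : Set (ℕ → Option (ℤ × E)) :=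
  {p | ∀ k ≤ n, p k = s k}

theorem cons_mem_cylinder_succ {a : Option (ℤ × E)} {p : ℕ → Option (ℤ × E)} {n : ℕ}
    {s : ℕ → Option (ℤ × E)} :
    cons a p ∈ cylinder (n + 1) s ↔ a = s 0 ∧ p ∈ cylinder n fun k => s (k + 1) := by
  constructor
  · intro h
    exact ⟨h 0 (Nat.zero_le _), fun k hk => h (k + 1) (by omega)⟩
  · rintro ⟨h0, h⟩ k hk
    cases k with
    | zero => exact h0
    | succ k => exact h k (by omega)

theorem measurableSet_cylinder (n : ℕ) (s : ℕ → Option (ℤ × E)) :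
    MeasurableSet (cylinder n s) := by
  have : cylinder n s = ⋂ k ≤ n, (fun p : ℕ → Option (ℤ × E) => p k) ⁻¹' {s k} := by
    ext p
    simp [cylinder]
  rw [this]
  exact MeasurableSet.iInter fun k => MeasurableSet.iInter fun _ =>
    measurable_pi_apply k (measurableSet_singleton _)

variable [Finite E]

/-- A function of a path that depends only on finitely many coordinates is measurable. -/
theorem measurable_of_agree {β : Type*} [MeasurableSpace β] {f : (ℕ → Option (ℤ × E)) → β} (n : ℕ)
    (h : ∀ p q, (∀ k ≤ n, p k = q k) → f p = f q) : Measurable f := by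
  let r : (ℕ → Option (ℤ × E)) → (Fin (n + 1) → Option (ℤ × E)) := fun p k => p k
  let e : (Fin (n + 1) → Option (ℤ × E)) → (ℕ → Option (ℤ × E)) :=
    fun s k => s (Fin.ofNat (n + 1) k)
  have hr : Measurable r := measurable_pi_iff.2 fun k => measurable_pi_apply _
  have : f = (f ∘ e) ∘ r := by
    ext1 p
    refine h _ _ fun k hk => ?_
    simp only [e, r, Fin.ofNat]
    rw [Nat.mod_eq_of_lt (by omega)]
  rw [this]
  exact (Measurable.of_discrete).comp hr

/-- Cylinders generate the σ-algebra because the state space is countable, and two cylinders with a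
common path p intersect in a cylinder around p, so the π-system theorem applies. -/
theorem measure_ext_cylinder {μ ν : Measure (ℕ → Option (ℤ × E))} [IsFiniteMeasure μ]
    (huniv : μ Set.univ = ν Set.univ) (h : ∀ n s, μ (cylinder n s) = ν (cylinder n s)) :
    μ = ν := by
  refine ext_of_generate_finite {c | ∃ n s, c = cylinder n s} ?_ ?_ ?_ huniv
  · refine le_antisymm ?_ ?_
    · refine iSup_le fun n => ?_
      rintro _ ⟨t, -, rfl⟩
      let e : (Fin (n + 1) → Option (ℤ × E)) → (ℕ → Option (ℤ × E)) :=
        fun s k => s (Fin.ofNat (n + 1) k)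
      have : (fun p : ℕ → Option (ℤ × E) => p n) ⁻¹' t =
          ⋃ s : {s : Fin (n + 1) → Option (ℤ × E) // s (Fin.last n) ∈ t}, cylinder n (e s) := by
        ext p
        simp only [Set.mem_preimage, Set.mem_iUnion, cylinder, Set.mem_ofPred_eq]
        constructor
        · intro hp
          refine ⟨⟨fun k => p k, by simpa using hp⟩, fun k hk => ?_⟩
          simp only [e, Fin.ofNat]
          rw [Nat.mod_eq_of_lt (by omega)]
        · rintro ⟨⟨s, hs⟩, hp⟩
          rw [hp n le_rfl]
          have : Fin.ofNat (n + 1) n = Fin.last n := by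
            ext
            simp
          simpa [e, this] using hs
      rw [this]
      exact MeasurableSet.iUnion fun s =>
        MeasurableSpace.measurableSet_generateFrom ⟨n, e s, rfl⟩
    · refine MeasurableSpace.generateFrom_le ?_
      rintro _ ⟨n, s, rfl⟩
      exact measurableSet_cylinder n s
  · rintro _ ⟨n, s, rfl⟩ _ ⟨m, t, rfl⟩ ⟨p, hp, hq⟩
    refine ⟨max n m, p, ?_⟩
    ext q
    constructor
    · rintro ⟨h1, h2⟩ k hk
      rcases le_max_iff.1 hk with hk | hk
      · rw [h1 k hk, hp k hk]
      · rw [h2 k hk, hq k hk]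
    · intro hq'
      exact ⟨fun k hk => (hq' k (hk.trans (le_max_left _ _))).trans (hp k hk),
        fun k hk => (hq' k (hk.trans (le_max_right _ _))).trans (hq k hk)⟩
  · rintro _ ⟨n, s, rfl⟩
    exact h n s

end MAC

/-! ### The Markov property at time one -/

namespace MACData.IsMAC

open MAC

variable {E : Type*} [Fintype E] {M : MACData E} {Ω : Type*} [MeasurableSpace Ω]
  {S : ℕ → Ω → Option (ℤ × E)} {ℙ : ℤ × E → Measure Ω}

theorem measurable_path (hS : M.IsMAC S ℙ) : Measurable fun ω n => S n ω :=
  measurable_pi_iff.2 fun n => measurable_to_countable' fun s => hS.measurable n s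

theorem ae_start (hS : M.IsMAC S ℙ) (a : ℤ × E) : ∀ᵐ ω ∂ℙ a, S 0 ω = some a := by
  have := hS.prob a
  have h := hS.law a 0 (fun _ => some a) rfl
  have h1 : {ω | ∀ k ≤ 0, S k ω = some a} = {ω | S 0 ω = some a} := by
    ext ω
    simp
  rw [h1] at h
  exact (prob_compl_eq_zero_iff (hS.measurable 0 _)).2 (by simpa using h)

theorem lintegral_eq_of_cons (hS : M.IsMAC S ℙ) (a : ℤ × E)
    {f : (ℕ → Option (ℤ × E)) → ℝ≥0∞} {c : ℝ≥0∞} (h : ∀ p, f (cons (some a) p) = c) :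
    ∫⁻ ω, f (fun n => S n ω) ∂ℙ a = c := by
  have := hS.prob a
  have : ∀ᵐ ω ∂ℙ a, f (fun n => S n ω) = c := by
    filter_upwards [hS.ae_start a] with ω hω
    rw [← h fun n => S (n + 1) ω, ← hω]
    exact congrArg f (cons_tail fun n => S n ω).symm
  rw [lintegral_congr_ae this]
  simp

end MACData.IsMAC

namespace MACData

theorem tsum_step {E : Type*} [Fintype E] (M : MACData E) (a : ℤ × E) (g : ℤ × E → ℝ≥0∞) :
    ∑' b, ENNReal.ofReal (M.step (some a) (some b)) * g b =
      ∑' m : ℤ, ∑ k, ENNReal.ofReal (M.A m a.2 k) * g (a.1 + m, k) := by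
  rw [ENNReal.tsum_prod', ← (Equiv.addLeft a.1).tsum_eq]
  refine tsum_congr fun m => ?_
  rw [tsum_fintype]
  simp [step]

theorem tsum_step_add_kill {E : Type*} [Fintype E] (M : MACData E) (a : ℤ × E) :
    ∑' b, ENNReal.ofReal (M.step (some a) (some b)) + ENNReal.ofReal M.kill = 1 := by
  have h := M.tsum_step a fun _ => 1
  simp only [mul_one, tsum_ofReal_A] at h
  rw [h, ← ENNReal.ofReal_add (by linarith [M.kill_lt_one]) M.kill_nonneg]
  simp

end MACData

namespace MACData.IsMAC

open MAC

variable {E : Type*} [Fintype E] {M : MACData E} {Ω : Type*} [MeasurableSpace Ω]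
  {S : ℕ → Ω → Option (ℤ × E)} {ℙ : ℤ × E → Measure Ω}

open Classical in
theorem map_cylinder (hS : M.IsMAC S ℙ) (a : ℤ × E) (n : ℕ) (s : ℕ → Option (ℤ × E)) :
    (ℙ a).map (fun ω n => S n ω) (cylinder n s) =
      if s 0 = some a then
        ENNReal.ofReal (∏ k ∈ Finset.range n, M.step (s k) (s (k + 1))) else 0 := by
  rw [Measure.map_apply hS.measurable_path (measurableSet_cylinder n s)]
  split_ifs with h
  · exact hS.law a n s h
  · refine measure_mono_null (fun ω hω => ?_) (hS.ae_start a)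
    intro h'
    exact h ((hω 0 (Nat.zero_le n)).symm.trans h')

-- The cemetery is absorbing: the product vanishes at the first exit of s from `none`, and otherwise
-- all its factors are 1. This matches the Dirac mass in `map_path_eq`.
open Classical in
theorem prod_step_none (M : MACData E) (n : ℕ) (s : ℕ → Option (ℤ × E)) (h0 : s 0 = none) :
    ENNReal.ofReal (∏ k ∈ Finset.range n, M.step (s k) (s (k + 1))) =
      if (fun _ => none) ∈ cylinder n s then 1 else 0 := by
  split_ifs with h
  · rw [Finset.prod_eq_one fun k hk => ?_, ENNReal.ofReal_one]
    have hk := Finset.mem_range.1 hk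
    rw [← h k hk.le, ← h (k + 1) hk]
    rfl
  · have hex : ∃ k, s k ≠ none ∧ k ≤ n := by
      by_contra hc
      push Not at hc
      refine h fun k hk => ?_
      by_contra hs
      exact absurd hk (not_le.2 (hc k (Ne.symm hs)))
    have h1 := Nat.find_spec hex
    obtain ⟨k, hk⟩ : ∃ k, Nat.find hex = k + 1 :=
      Nat.exists_eq_succ_of_ne_zero fun hz => (hz ▸ h1).1 h0
    have h2 : s k = none := by
      have := Nat.find_min hex (m := k) (by omega)
      by_contra hc
      exact this ⟨hc, by omega⟩
    rw [hk] at h1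
    obtain ⟨b, hb⟩ := Option.ne_none_iff_exists'.1 h1.1
    rw [Finset.prod_eq_zero (Finset.mem_range.2 (by omega : k < n)), ENNReal.ofReal_zero]
    rw [h2, hb]
    rfl

/-- The Markov property at time one, for the law of the whole path. -/
theorem map_path_eq (hS : M.IsMAC S ℙ) (a : ℤ × E) :
    (ℙ a).map (fun ω n => S n ω) =
      Measure.sum (fun b => ENNReal.ofReal (M.step (some a) (some b)) •
        ((ℙ b).map (fun ω n => S n ω)).map (cons (some a))) +
      ENNReal.ofReal M.kill • Measure.dirac (cons (some a) fun _ => none) := by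
  classical
  have hprob : ∀ b, IsProbabilityMeasure ((ℙ b).map (fun ω n => S n ω)) := fun b =>
    have := hS.prob b
    Measure.isProbabilityMeasure_map hS.measurable_path.aemeasurable
  have key : ∀ {c : Set (ℕ → Option (ℤ × E))}, MeasurableSet c →
      (Measure.sum (fun b => ENNReal.ofReal (M.step (some a) (some b)) •
        ((ℙ b).map (fun ω n => S n ω)).map (cons (some a))) +
      ENNReal.ofReal M.kill • Measure.dirac (cons (some a) fun _ => none)) c =
      ∑' b, ENNReal.ofReal (M.step (some a) (some b)) *
        ((ℙ b).map (fun ω n => S n ω)) (cons (some a) ⁻¹' c) +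
      ENNReal.ofReal M.kill * if (cons (some a) fun _ => none) ∈ c then 1 else 0 := by
    intro c hc
    rw [Measure.add_apply, Measure.sum_apply _ hc]
    simp only [Measure.smul_apply, smul_eq_mul, Measure.map_apply (measurable_cons _) hc,
      Measure.dirac_apply' _ hc, Set.indicator_apply, Pi.one_apply]
  refine measure_ext_cylinder ?_ fun n s => ?_
  · rw [key MeasurableSet.univ]
    simp [M.tsum_step_add_kill]
  rw [key (measurableSet_cylinder n s), hS.map_cylinder]
  by_cases h0 : s 0 = some a
  · cases n with
    | zero =>
      have h1 : ∀ p, cons (some a) p ∈ cylinder 0 s := fun p k hk => by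
        obtain rfl := Nat.le_zero.1 hk
        exact h0.symm
      have h2 : cons (some a) ⁻¹' cylinder 0 s = Set.univ := Set.eq_univ_of_forall h1
      simp [h1, h2, h0, M.tsum_step_add_kill]
    | succ n =>
      have h2 : cons (some a) ⁻¹' cylinder (n + 1) s = cylinder n fun k => s (k + 1) := by
        ext p
        simp [cons_mem_cylinder_succ, h0]
      rw [if_pos h0, h2]
      simp only [hS.map_cylinder, zero_add, cons_mem_cylinder_succ, h0, true_and]
      have hnn : 0 ≤ M.step (some a) (s 1) := by
        cases s 1 with
        | none => exact M.kill_nonneg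
        | some b => exact M.nonneg _ _ _
      rw [Finset.prod_range_succ', mul_comm, zero_add, h0, ENNReal.ofReal_mul hnn]
      cases h1 : s 1 with
      | none =>
        rw [prod_step_none M n (fun k => s (k + 1)) h1]
        simp
        rfl
      | some b =>
        have h3 : ¬ (fun _ => none) ∈ cylinder n fun k => s (k + 1) := fun h => by
          have := h 0 (Nat.zero_le n)
          simp [h1] at this
        rw [tsum_eq_single b fun c hc => by simp [hc.symm]]
        simp [h3]
  · have h1 : ∀ p, cons (some a) p ∉ cylinder n s := fun p hp => h0 (hp 0 (Nat.zero_le n)).symm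
    have h2 : cons (some a) ⁻¹' cylinder n s = ∅ := Set.eq_empty_of_forall_notMem h1
    simp [h0, h1, h2]

/-- First step analysis. -/
theorem lintegral_firstStep (hS : M.IsMAC S ℙ) (x : ℤ) (i : E)
    {f : (ℕ → Option (ℤ × E)) → ℝ≥0∞} (hf : Measurable f)
    (h0 : f (cons (some (x, i)) fun _ => none) = 0) :
    ∫⁻ ω, f (fun n => S n ω) ∂ℙ (x, i) =
      ∑' m : ℤ, ∑ k, ENNReal.ofReal (M.A m i k) *
        ∫⁻ ω, f (cons (some (x, i)) fun n => S n ω) ∂ℙ (x + m, k) := by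
  rw [← lintegral_map hf hS.measurable_path, hS.map_path_eq, lintegral_add_measure,
    lintegral_sum_measure, lintegral_smul_measure, lintegral_dirac' _ hf, h0, smul_zero, add_zero,
    ← M.tsum_step (x, i) fun b => ∫⁻ ω, f (cons (some (x, i)) fun n => S n ω) ∂ℙ b]
  refine tsum_congr fun b => ?_
  rw [lintegral_smul_measure, lintegral_map hf (measurable_cons _),
    lintegral_map (f := fun p => f (cons (some (x, i)) p)) (hf.comp (measurable_cons _))
      hS.measurable_path]
  rfl

end MACData.IsMAC

/-! ### Probabilistic meaning of the stopped sums: L, L(n) and the hitting matrices -/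

namespace MAC

variable {E : Type*}

/-- The level is in `C` and the phase is `j` at time `n`, and the level was outside `B` before. -/
def stopEvent (B C : Set ℤ) (n : ℕ) (j : E) : Set (ℕ → Option (ℤ × E)) :=
  {p | (∃ c ∈ C, p n = some (c, j)) ∧ ∀ l < n, ∀ b ∈ B, (p l).map Prod.fst ≠ some b}

theorem measurableSet_stopEvent [Finite E] (B C : Set ℤ) (n : ℕ) (j : E) :
    MeasurableSet (stopEvent B C n j) := by
  refine measurableSet_setOfPred.2 (measurable_of_agree n fun p q h => ?_)
  have h1 : ∀ l < n, p l = q l := fun l hl => h l hl.le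
  simp only [h n le_rfl, eq_iff_iff]
  refine and_congr_right fun _ => forall_congr' fun l => forall_congr' fun hl => ?_
  rw [h1 l hl]

theorem cons_mem_stopEvent_succ {B C : Set ℤ} {n : ℕ} {j : E} {x : ℤ} {i : E}
    {p : ℕ → Option (ℤ × E)} :
    cons (some (x, i)) p ∈ stopEvent B C (n + 1) j ↔ x ∉ B ∧ p ∈ stopEvent B C n j := by
  constructor
  · rintro ⟨h1, h2⟩
    refine ⟨fun hx => h2 0 (Nat.succ_pos n) x hx rfl, h1, fun l hl => h2 (l + 1) (by omega)⟩
  · rintro ⟨hx, h1, h2⟩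
    refine ⟨h1, fun l hl b hb => ?_⟩
    cases l with
    | zero =>
      intro h
      simp only [cons_zero, Option.map_some, Option.some.injEq] at h
      exact hx (h ▸ hb)
    | succ l => exact h2 l (by omega) b hb

end MAC

namespace MACData

variable {E : Type*} [Fintype E] [DecidableEq E]

theorem stopped_singleton_shift (M : MACData E) (y : ℤ) (n : ℕ) (x : ℤ) :
    M.stopped {y} {y} n x = M.stopped {0} {0} n (x - y) := by
  induction n generalizing x with
  | zero => simp [stopped, sub_eq_zero]
  | succ n ih =>
    have h : M.transfer (M.stopped {y} {y} n) x = M.transfer (M.stopped {0} {0} n) (x - y) := by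
      rw [sub_eq_add_neg, ← transfer_shift]
      exact M.transfer_congr fun m _ => ih _
    simp [stopped, sub_eq_zero, h]

/-- With B = C = {0} the sum over time is a hitting probability, so induction on the first step
bounds every partial sum by 1. -/
theorem green_hit_ne_top (M : MACData E) (x : ℤ) (i j : E) :
    M.green {0} {0} x i j ≠ ⊤ := by
  suffices h : ∀ n, ∀ x, ∑ k ∈ Finset.range n, M.stopped {0} {0} k x i j ≤ 1 from
    ne_top_of_le_ne_top ENNReal.one_ne_top (ENNReal.tsum_le_of_sum_range_le fun n => h n x)
  intro n x
  induction n generalizing x i with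
  | zero => simp
  | succ n ih =>
    rw [Finset.sum_range_succ']
    by_cases hx : x = 0
    · simp only [stopped, hx, Set.mem_singleton_iff, if_true, Matrix.zero_apply,
        Finset.sum_const_zero, zero_add, Matrix.one_apply]
      split_ifs <;> simp
    · simp only [stopped, hx, Set.mem_singleton_iff, if_false, Matrix.zero_apply, add_zero]
      rw [← Matrix.sum_apply, ← transfer_sum]
      refine (M.transfer_mono fun m hm k => ?_).trans (M.transfer_const_le 1 x i j)
      simp only [Matrix.sum_apply, Matrix.of_apply]
      exact ih k (x + m)

end MACData

namespace MACData.IsMAC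

open MAC

variable {E : Type*} [Fintype E] [DecidableEq E] {M : MACData E} {Ω : Type*} [MeasurableSpace Ω]
  {S : ℕ → Ω → Option (ℤ × E)} {ℙ : ℤ × E → Measure Ω}

theorem lintegral_stopEvent (hS : M.IsMAC S ℙ) (B C : Set ℤ) (n : ℕ) (x : ℤ) (i j : E) :
    ∫⁻ ω, (stopEvent B C n j).indicator 1 (fun n => S n ω) ∂ℙ (x, i) =
      M.stopped B C n x i j := by
  classical
  induction n generalizing x i with
  | zero =>
    refine hS.lintegral_eq_of_cons (x, i) fun p => ?_
    have : cons (some (x, i)) p ∈ stopEvent B C 0 j ↔ x ∈ C ∧ i = j := by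
      constructor
      · rintro ⟨⟨c, hc, h⟩, -⟩
        simp only [cons_zero, Option.some.injEq, Prod.mk.injEq] at h
        exact ⟨h.1 ▸ hc, h.2⟩
      · rintro ⟨hx, rfl⟩
        exact ⟨⟨x, hx, rfl⟩, fun l hl => absurd hl (Nat.not_lt_zero l)⟩
    simp only [Set.indicator_apply, this, stopped, Pi.one_apply]
    by_cases hx : x ∈ C <;> simp [hx, Matrix.one_apply]
  | succ n ih =>
    rw [hS.lintegral_firstStep x i
      (measurable_one.indicator (measurableSet_stopEvent B C (n + 1) j))]
    · by_cases hx : x ∈ B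
      · simp [cons_mem_stopEvent_succ, stopped, hx]
      · simp only [stopped, hx, if_false, transfer, Matrix.of_apply]
        simp only [← ih, Set.indicator_apply, cons_mem_stopEvent_succ, hx, not_false_eq_true,
          true_and, Pi.one_apply]
    · refine Set.indicator_of_notMem ?_ _
      rintro ⟨⟨c, -, h⟩, -⟩
      simp at h

theorem measure_stopEvent (hS : M.IsMAC S ℙ) (B C : Set ℤ) (n : ℕ) (x : ℤ) (i j : E) :
    ℙ (x, i) {ω | (fun n => S n ω) ∈ stopEvent B C n j} = M.stopped B C n x i j := by
  rw [← hS.lintegral_stopEvent]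
  exact (lintegral_indicator_one
    (hS.measurable_path (measurableSet_stopEvent B C n j))).symm

theorem lintegral_tsum_stopEvent (hS : M.IsMAC S ℙ) (B C : Set ℤ) (x : ℤ) (i j : E) :
    ∫⁻ ω, ∑' n, (stopEvent B C n j).indicator 1 (fun n => S n ω) ∂ℙ (x, i) =
      M.green B C x i j := by
  refine (lintegral_tsum fun n => ((measurable_one.indicator
    (measurableSet_stopEvent B C n j)).comp hS.measurable_path).aemeasurable).trans ?_
  exact tsum_congr fun n => hS.lintegral_stopEvent B C n x i j

theorem occ_eq (hS : M.IsMAC S ℙ) (i j : E) : occ S ℙ i j = M.visits ∅ 0 i j := by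
  classical
  rw [visits, ← hS.lintegral_tsum_stopEvent]
  refine lintegral_congr fun ω => tsum_congr fun k => ?_
  simp [Set.indicator_apply, stopEvent]

theorem LBefore_eq (hS : M.IsMAC S ℙ) (n : ℕ) :
    LBefore S ℙ n = (M.visits {(n : ℤ)} 0).map ENNReal.toReal := by
  classical
  ext i j
  rw [Matrix.map_apply, visits, ← hS.lintegral_tsum_stopEvent]
  refine congrArg ENNReal.toReal (lintegral_congr fun ω => tsum_congr fun k => ?_)
  simp only [Set.indicator_apply]
  refine if_congr ?_ rfl rfl
  simp only [hitTime, coe_lt_firstTime]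
  constructor
  · rintro ⟨h1, h2⟩
    refine ⟨⟨0, ⟨rfl, fun h0 => h2 k le_rfl ?_⟩, h1⟩, fun l hl b hb => ?_⟩
    · rw [h1, ← Set.mem_singleton_iff.1 h0]
      rfl
    · rw [Set.mem_singleton_iff.1 hb]
      exact h2 l hl.le
  · rintro ⟨⟨c, ⟨hc, hcn⟩, h1⟩, h2⟩
    obtain rfl := Set.mem_singleton_iff.1 hc
    refine ⟨h1, fun l hl => ?_⟩
    rcases hl.lt_or_eq with hl | rfl
    · exact h2 l hl n rfl
    · intro h
      simp only [h1, Option.map_some, Option.some.injEq] at h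
      exact hcn h

theorem hitMatrix_eq (hS : M.IsMAC S ℙ) (y : ℤ) :
    hitMatrix S ℙ y = (M.green {0} {0} (-y)).map ENNReal.toReal := by
  ext i j
  refine congrArg ENNReal.toReal ?_
  have hset : {ω | hitTime S y ω ≠ ⊤ ∧ S (hitTime S y ω).toNat ω = some (y, j)} =
      ⋃ n, {ω | (fun n => S n ω) ∈ stopEvent {y} {y} n j} := by
    ext ω
    simp only [Set.mem_ofPred_eq, Set.mem_iUnion]
    constructor
    · rintro ⟨h1, h2⟩
      obtain ⟨n, hn⟩ := ENat.ne_top_iff_exists.1 h1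
      rw [← hn, ENat.toNat_natCast] at h2
      refine ⟨n, ⟨y, rfl, h2⟩, fun l hl b hb => ?_⟩
      rw [Set.mem_singleton_iff.1 hb]
      exact (firstTime_eq_coe.1 hn.symm).2 l hl
    · rintro ⟨n, ⟨c, hc, h1⟩, h2⟩
      rw [Set.mem_singleton_iff.1 hc] at h1
      have : hitTime S y ω = n := firstTime_eq_coe.2
        ⟨congrArg (Option.map Prod.fst) h1, fun k hk => h2 k hk y rfl⟩
      rw [this, ENat.toNat_natCast]
      exact ⟨ENat.natCast_ne_top n, h1⟩
  rw [hset, measure_iUnion]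
  · simp only [green, Matrix.of_apply, hS.measure_stopEvent, stopped_singleton_shift M y, zero_sub]
  · have key : ∀ m n, m < n → Disjoint {ω | (fun n => S n ω) ∈ stopEvent {y} {y} m j}
        {ω | (fun n => S n ω) ∈ stopEvent {y} {y} n j} := by
      intro m n hmn
      refine Set.disjoint_left.2 ?_
      rintro ω ⟨⟨c, hc, h⟩, -⟩ ⟨-, h2⟩
      refine h2 m hmn c hc ?_
      rw [h]
      rfl
    intro m n hmn
    rcases lt_or_gt_of_ne hmn with h | h
    · exact key m n h
    · exact (key n m h).symm
  · exact fun n => hS.measurable_path (measurableSet_stopEvent {y} {y} n j)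

end MACData.IsMAC

/-! ### Passage to real matrices -/

namespace Matrix

variable {E : Type*} [Fintype E]

theorem map_toReal_mul {X Y : Matrix E E ℝ≥0∞} (hX : ∀ i j, X i j ≠ ⊤) (hY : ∀ i j, Y i j ≠ ⊤) :
    (X * Y).map ENNReal.toReal = X.map ENNReal.toReal * Y.map ENNReal.toReal := by
  ext i j
  simp only [map_apply, mul_apply]
  rw [ENNReal.toReal_sum fun k _ => ENNReal.mul_ne_top (hX i k) (hY k j)]
  simp only [ENNReal.toReal_mul]

omit [Fintype E] in
theorem map_toReal_add {X Y : Matrix E E ℝ≥0∞} (hX : ∀ i j, X i j ≠ ⊤) (hY : ∀ i j, Y i j ≠ ⊤) :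
    (X + Y).map ENNReal.toReal = X.map ENNReal.toReal + Y.map ENNReal.toReal := by
  ext i j
  exact ENNReal.toReal_add (hX i j) (hY i j)

theorem mul_ne_top {X Y : Matrix E E ℝ≥0∞} (hX : ∀ i j, X i j ≠ ⊤) (hY : ∀ i j, Y i j ≠ ⊤)
    (i j : E) : (X * Y) i j ≠ ⊤ := by
  simp only [mul_apply]
  exact ENNReal.sum_ne_top.2 fun k _ => ENNReal.mul_ne_top (hX i k) (hY k j)

omit [Fintype E] in
theorem map_toReal_one [DecidableEq E] :
    (1 : Matrix E E ℝ≥0∞).map ENNReal.toReal = 1 := by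
  ext i j
  simp only [map_apply, one_apply]
  split_ifs <;> simp

/-- A kernel vector is tested as a square matrix with all columns equal, so that identities for
matrix-valued functions apply directly. -/
theorem isUnit_of_mul_eq_zero [DecidableEq E] {X : Matrix E E ℝ}
    (h : ∀ B : Matrix E E ℝ, X * B = 0 → B = 0) : IsUnit X := by
  refine mulVec_injective_iff_isUnit.1 ((injective_iff_map_eq_zero X.mulVecLin).2 fun v hv => ?_)
  have h1 : (of fun i (_ : E) => v i) = 0 := h _ (by
    ext i j
    exact congrFun hv i)
  ext i
  exact congrFun (congrFun h1 i) i

end Matrix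

namespace MACData

open MAC

variable {E : Type*} [Fintype E]

theorem hasSum_transfer (M : MACData E) {f : ℤ → Matrix E E ℝ≥0∞} {x : ℤ}
    (hf : ∀ m ≤ 1, ∀ k j, f (x + m) k j ≠ ⊤) (hx : ∀ i j, M.transfer f x i j ≠ ⊤) :
    HasSum (fun m => M.A m * (f (x + m)).map ENNReal.toReal)
      ((M.transfer f x).map ENNReal.toReal) := by
  refine Pi.hasSum.2 fun i => Pi.hasSum.2 fun j => ?_
  have hne : ∀ m k, ENNReal.ofReal (M.A m i k) * f (x + m) k j ≠ ⊤ := by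
    intro m k
    by_cases hm : m ≤ 1
    · exact ENNReal.mul_ne_top ENNReal.ofReal_ne_top (hf m hm k j)
    · simp [M.skipFree m (not_le.1 hm)]
  have h := ENNReal.hasSum_toReal (hx i j)
  rw [← ENNReal.tsum_toReal_eq fun m => ENNReal.sum_ne_top.2 fun k _ => hne m k] at h
  refine h.congr_fun fun m => ?_
  rw [Matrix.mul_apply, ENNReal.toReal_sum fun k _ => hne m k]
  simp [ENNReal.toReal_mul, ENNReal.toReal_ofReal (M.nonneg _ _ _)]

/-- Only m ≤ 1 contributes, and there z^{-m} ≤ z^{-1}. -/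
theorem hasSum_F (M : MACData E) {z : ℝ} (hz : z ∈ Set.Ioc (0 : ℝ) 1) :
    HasSum (fun m => z ^ (-m) • M.A m) (M.F z) := by
  refine Pi.hasSum.2 fun i => Pi.hasSum.2 fun j => ?_
  refine Summable.hasSum (Summable.of_nonneg_of_le
    (fun m => mul_nonneg (zpow_nonneg hz.1.le _) (M.nonneg m i j)) (fun m => ?_)
    ((M.summable i j).mul_left z⁻¹))
  by_cases hm : m ≤ 1
  · refine mul_le_mul_of_nonneg_right ?_ (M.nonneg m i j)
    have h1 : z ^ (-m) = z⁻¹ * z ^ (1 - m).toNat := by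
      rw [← zpow_natCast, Int.toNat_of_nonneg (by omega), ← zpow_neg_one, ← zpow_add₀ hz.1.ne']
      congr 1
      ring
    rw [h1]
    exact mul_le_of_le_one_right (inv_nonneg.2 hz.1.le) (pow_le_one₀ hz.1.le hz.2)
  · simp [M.skipFree m (not_le.1 hm)]

theorem hasSum_congr_of_le_one (M : MACData E) {f g : ℤ → Matrix E E ℝ} {c : Matrix E E ℝ}
    (h : HasSum (fun m => M.A m * f m) c) (hfg : ∀ m ≤ 1, g m = f m) :
    HasSum (fun m => M.A m * g m) c := by
  refine h.congr_fun fun m => ?_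
  by_cases hm : m ≤ 1
  · rw [hfg m hm]
  · simp [M.skipFree m (not_le.1 hm)]

variable [DecidableEq E]

/-! ### The matrix G and the scale matrix W -/

/-- The fundamental matrix of the upward passage through one level. -/
noncomputable def passage (M : MACData E) : Matrix E E ℝ :=
  (M.green {0} {0} (-1)).map ENNReal.toReal

theorem map_green_hit_neg (M : MACData E) (n : ℕ) :
    (M.green {0} {0} (-(n : ℤ))).map ENNReal.toReal = M.passage ^ n := by
  induction n with
  | zero => simp [green_hit_self, Matrix.map_toReal_one]
  | succ n ih =>
    rw [green_hit_succ M _ (by push_cast; omega), Matrix.map_toReal_mul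
      (M.green_hit_ne_top _) (M.green_hit_ne_top _), pow_succ, ← ih, passage]
    congr 3
    push_cast
    ring

theorem hasSum_passage (M : MACData E) :
    HasSum (fun m => M.A m * M.passage ^ (1 - m).toNat) M.passage := by
  have h1 : M.green {0} {0} (-1) = M.transfer (M.green {0} {0}) (-1) := by
    rw [green_eq]
    simp
  have h := M.hasSum_transfer (f := M.green {0} {0}) (x := -1)
    (fun m _ => M.green_hit_ne_top _) (by rw [← h1]; exact M.green_hit_ne_top _)
  rw [← h1] at h
  refine M.hasSum_congr_of_le_one h fun m hm => ?_
  rw [← map_green_hit_neg]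
  congr 2
  omega

/-- If G B = 0, multiplying G = ∑ A_m G^{1-m} by B leaves only the term m = 1, so A_1 B = 0 and B =
0. -/
theorem isUnit_passage (M : MACData E) (hA : IsUnit (M.A 1)) : IsUnit M.passage := by
  refine Matrix.isUnit_of_mul_eq_zero fun B hB => ?_
  have h := M.hasSum_passage.mul_right B
  rw [hB] at h
  have h1 : M.A 1 * B = 0 := by
    refine HasSum.unique (hasSum_single (f := fun m => M.A m * M.passage ^ (1 - m).toNat * B) 1
      fun m hm => ?_) h |>.symm.trans ?_ |>.symm
    · rcases lt_or_gt_of_ne hm with hm | hm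
      · obtain ⟨k, hk⟩ : ∃ k, (1 - m).toNat = k + 1 := ⟨(-m).toNat, by omega⟩
        simp only [hk, pow_succ, mul_assoc, hB, mul_zero]
      · simp [M.skipFree m hm]
    · simp
  exact hA.mul_right_eq_zero.1 h1

/-- The scale matrix `W`, extended by zero to negative levels. -/
noncomputable def scaleW (M : MACData E) (n : ℤ) : Matrix E E ℝ :=
  M.passage⁻¹ ^ n.toNat * (M.visits {(n.toNat : ℤ)} 0).map ENNReal.toReal

theorem scaleW_of_nonpos (M : MACData E) {n : ℤ} (hn : n ≤ 0) : M.scaleW n = 0 := by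
  have : n.toNat = 0 := by omega
  rw [scaleW, this, visits_eq_zero M (by simp)]
  ext
  simp

theorem IsMAC.W_eq {M : MACData E} (hA : IsUnit (M.A 1)) {Ω : Type*} [MeasurableSpace Ω]
    {S : ℕ → Ω → Option (ℤ × E)} {ℙ : ℤ × E → Measure Ω} (hS : M.IsMAC S ℙ) (n : ℕ) :
    MAC.W S ℙ n = M.scaleW n := by
  have hG : G S ℙ = M.passage := hS.hitMatrix_eq 1
  rw [W, scaleW, Int.toNat_natCast, ← hS.LBefore_eq, hG]
  split_ifs with h
  -- For finite L, splitting the visits at the passage through n gives L = L(n) + G^n P(J_{τ^{-n}})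
  -- L; multiplying by G^{-n} shows that the two definitions of W agree.
  · simp only [hS.occ_eq] at h
    have hV : M.visits ∅ n = M.green {0} {0} n * M.visits ∅ 0 := by
      simpa [visits] using M.green_eq_hit_mul n
    have h1 := M.visits_eq_add (B := ∅) (N := n) (x := 0) (by simp) (by simp)
    rw [zero_sub, hV] at h1
    have h2 := congrArg (fun X => X.map ENNReal.toReal) h1
    have hvis := M.visits_ne_top hA n (Int.natCast_nonneg n)
    have hgr := M.green_hit_ne_top (n : ℤ)
    have hgr' := M.green_hit_ne_top (-(n : ℤ))
    have hfin := Matrix.mul_ne_top hgr h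
    beta_reduce at h2
    rw [Matrix.map_toReal_add hvis (Matrix.mul_ne_top hgr' hfin), Matrix.map_toReal_mul hgr' hfin,
      Matrix.map_toReal_mul hgr h, map_green_hit_neg, ← hS.LBefore_eq] at h2
    have hL : L S ℙ = (M.visits ∅ 0).map ENNReal.toReal := by
      ext i j
      exact congrArg ENNReal.toReal (hS.occ_eq i j)
    rw [hS.hitMatrix_eq, neg_neg, hL]
    have h3 : M.passage⁻¹ ^ n * M.passage ^ n = 1 := by
      rw [Matrix.inv_pow', Matrix.nonsing_inv_mul _
        ((Matrix.isUnit_iff_isUnit_det _).1 ((M.isUnit_passage hA).pow n))]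
    have h4 : LBefore S ℙ n = (M.visits ∅ 0).map ENNReal.toReal - M.passage ^ n *
        ((M.green {0} {0} n).map ENNReal.toReal * (M.visits ∅ 0).map ENNReal.toReal) :=
      eq_sub_of_add_eq h2.symm
    rw [h4, mul_sub, ← mul_assoc _ (M.passage ^ n), h3, one_mul, sub_mul]
  · rfl

/-- For 0 ≤ x ≤ N, split the visits before N, started at 0, at the passage through x: V_N(0) =
V_x(0) + G^x V_N(x), then multiply by G^{-x}. For x ≤ 0 the right side cancels, since V_N(x) =
G^{-x} V_N(0). The unit g gives access to integer powers of G. -/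
theorem scaleW_eq (M : MACData E) (hA : IsUnit (M.A 1)) {g : (Matrix E E ℝ)ˣ}
    (hg : (g : Matrix E E ℝ) = M.passage) (N : ℕ) {x : ℤ} (hx : x ≤ N) :
    M.scaleW x = ((g ^ ((N : ℤ) - x) : (Matrix E E ℝ)ˣ) : Matrix E E ℝ) * M.scaleW N -
      (M.visits {(N : ℤ)} x).map ENNReal.toReal := by
  have hinv : ∀ n : ℕ, M.passage⁻¹ ^ n = ((g ^ (-(n : ℤ)) : (Matrix E E ℝ)ˣ) : Matrix E E ℝ) := by
    intro n
    rw [← hg, ← Matrix.coe_units_inv, ← Units.val_pow_eq_pow_val, zpow_neg, zpow_natCast, inv_pow]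
  have hW : M.scaleW N = ((g ^ (-(N : ℤ)) : (Matrix E E ℝ)ˣ) : Matrix E E ℝ) *
      (M.visits {(N : ℤ)} 0).map ENNReal.toReal := by
    rw [scaleW, Int.toNat_natCast, hinv]
  rw [hW, ← mul_assoc, ← Units.val_mul, ← zpow_add]
  have hgr := M.green_hit_ne_top
  rcases le_total 0 x with h0 | h0
  · obtain ⟨n, rfl⟩ := Int.eq_ofNat_of_zero_le h0
    have h1 := M.visits_eq_add (B := {(N : ℤ)}) (N := n) (x := 0)
      (fun y hy => hx.trans_eq (Set.mem_singleton_iff.1 hy).symm) h0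
    have hvN := M.visits_ne_top hA N hx
    rw [h1, zero_sub, Matrix.map_toReal_add (M.visits_ne_top hA n h0)
      (Matrix.mul_ne_top (hgr _) hvN), Matrix.map_toReal_mul (hgr _) hvN, map_green_hit_neg,
      mul_add, ← mul_assoc, ← hg, ← Units.val_pow_eq_pow_val, ← Units.val_mul, ← zpow_natCast,
      ← zpow_add, scaleW, Int.toNat_natCast, hinv]
    have e1 : (N : ℤ) - n + -N = -n := by ring
    rw [e1, neg_add_cancel, zpow_zero, Units.val_one, one_mul, add_sub_cancel_right]
  · obtain ⟨n, rfl⟩ := Int.exists_eq_neg_ofNat h0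
    have h1 := M.visits_eq_add (B := {(N : ℤ)}) (N := 0) (x := -(n : ℤ))
      (fun y hy => (Int.natCast_nonneg N).trans_eq (Set.mem_singleton_iff.1 hy).symm) h0
    have hv := M.visits_ne_top hA N (Int.natCast_nonneg N)
    rw [scaleW_of_nonpos M h0, h1, visits_zero_eq_zero, zero_add, sub_zero,
      Matrix.map_toReal_mul (hgr _) hv, map_green_hit_neg, ← hg, ← Units.val_pow_eq_pow_val,
      ← zpow_natCast]
    simp

theorem hasSum_scaleW (M : MACData E) (hA : IsUnit (M.A 1)) (x : ℤ) :
    HasSum (fun m => M.A m * M.scaleW (x + m)) (M.scaleW x + if x = 0 then 1 else 0) := by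
  obtain ⟨g, hg⟩ := M.isUnit_passage hA
  -- N lies at or above every level reachable from x in one step, so the representation `scaleW_eq`
  -- holds at all x + m with m ≤ 1.
  obtain ⟨N, hN⟩ : ∃ N : ℕ, x + 1 ≤ N := ⟨(x + 1).toNat, Int.self_le_toNat _⟩
  have h1 := (M.hasSum_passage.mul_right
    ((g ^ ((N : ℤ) - x - 1) : (Matrix E E ℝ)ˣ) : Matrix E E ℝ)).mul_right (M.scaleW N)
  have hx : x ∉ ({(N : ℤ)} : Set ℤ) := by
    rw [Set.mem_singleton_iff]
    omega
  have hvis := M.visits_eq hx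
  have hfin : ∀ i j, M.transfer (M.visits {(N : ℤ)}) x i j ≠ ⊤ := fun i j => by
    refine ne_top_of_le_ne_top (M.visits_ne_top hA N (x := x) (by omega) i j) ?_
    rw [hvis]
    exact le_add_self
  have h2 := M.hasSum_transfer (f := M.visits {(N : ℤ)}) (x := x)
    (fun m hm => M.visits_ne_top hA N (by omega)) hfin
  have h3 := h1.sub h2
  have hvr : (M.visits {(N : ℤ)} x).map ENNReal.toReal = (if x = 0 then 1 else 0) +
      (M.transfer (M.visits {(N : ℤ)}) x).map ENNReal.toReal := by
    rw [hvis, Matrix.map_toReal_add _ hfin]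
    · congr 1
      split_ifs
      · exact Matrix.map_toReal_one
      · ext
        simp
    · intro i j
      split_ifs
      · rw [Matrix.one_apply]
        split_ifs <;> simp
      · simp
  have h4 : M.scaleW x + (if x = 0 then 1 else 0) = M.passage *
      ((g ^ ((N : ℤ) - x - 1) : (Matrix E E ℝ)ˣ) : Matrix E E ℝ) * M.scaleW N -
      (M.transfer (M.visits {(N : ℤ)}) x).map ENNReal.toReal := by
    rw [M.scaleW_eq hA hg N (by omega : x ≤ N), hvr, ← hg, ← Units.val_mul, ← zpow_one_add]
    have : 1 + ((N : ℤ) - x - 1) = N - x := by ring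
    rw [this]
    abel
  rw [h4]
  refine (M.hasSum_congr_of_le_one (g := fun m => M.scaleW (x + m)) (f := fun m =>
    M.passage ^ (1 - m).toNat * ((g ^ ((N : ℤ) - x - 1) : (Matrix E E ℝ)ˣ) : Matrix E E ℝ) *
      M.scaleW N - (M.visits {(N : ℤ)} (x + m)).map ENNReal.toReal) ?_ fun m hm => ?_)
  · refine h3.congr_fun fun m => ?_
    simp only [mul_sub, mul_assoc]
  · rw [M.scaleW_eq hA hg N (by omega : x + m ≤ N), ← hg, ← Units.val_pow_eq_pow_val,
      ← Units.val_mul, ← zpow_natCast, ← zpow_add, Int.toNat_of_nonneg (by omega)]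
    congr 4
    ring

/-! ### Partial sums of W and harmonicity of Z -/

/-- The weighted partial sums of the scale matrix. -/
noncomputable def sumW (M : MACData E) (z : ℝ) (n : ℤ) : Matrix E E ℝ :=
  ∑ k ∈ Finset.range n.toNat, z ^ k • M.scaleW k

theorem sumW_succ (M : MACData E) (z : ℝ) (n : ℤ) :
    M.sumW z (n + 1) = M.sumW z n + z ^ n • M.scaleW n := by
  rcases le_or_gt 0 n with h | h
  · obtain ⟨k, rfl⟩ := Int.eq_ofNat_of_zero_le h
    have : ((k : ℤ) + 1).toNat = k + 1 := by omega
    simp [sumW, this, Finset.sum_range_succ]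
  · have h1 : (n + 1).toNat = 0 := by omega
    have h2 : n.toNat = 0 := by omega
    simp [sumW, h1, h2, M.scaleW_of_nonpos h.le]

theorem sumW_of_le_one (M : MACData E) (z : ℝ) {n : ℤ} (hn : n ≤ 1) : M.sumW z n = 0 := by
  refine Finset.sum_eq_zero fun k hk => ?_
  have := Finset.mem_range.1 hk
  rw [scaleW_of_nonpos M (by omega), smul_zero]

/-- Increasing n adds z^n times the equation of `hasSum_scaleW` at level n. The unit source enters
once, at level 0, and persists. -/
theorem hasSum_sumW (M : MACData E) (hA : IsUnit (M.A 1)) {z : ℝ} (hz : 0 < z) (n : ℕ) :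
    HasSum (fun m => M.A m * (z ^ (-m) • M.sumW z (n + m)))
      (M.sumW z n + if n = 0 then 0 else 1) := by
  induction n with
  | zero =>
    refine M.hasSum_congr_of_le_one (f := fun _ => 0) ?_ fun m hm => ?_
    · simp [sumW]
    · rw [M.sumW_of_le_one z (by simpa using hm), smul_zero]
  | succ n ih =>
    have h := ih.add ((M.hasSum_scaleW hA n).const_smul (z ^ n))
    push_cast
    rw [sumW_succ]
    refine Eq.subst (motive := fun c => HasSum _ c) ?_ (h.congr_fun fun m => ?_)
    swap
    · have h1 : (n : ℤ) + 1 + m = n + m + 1 := by ring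
      have h2 : z ^ (-m) * z ^ ((n : ℤ) + m) = z ^ n := by
        rw [← zpow_add₀ hz.ne', ← zpow_natCast]
        congr 1
        ring
      rw [h1, sumW_succ, smul_add, mul_add, smul_smul, h2, mul_smul_comm (z ^ n)]
    · by_cases hn : n = 0
      · subst hn
        simp [add_assoc]
      · simp only [hn, Nat.cast_eq_zero, if_false, add_zero]
        abel

/-- The scale matrix `Z` at integer levels. -/
noncomputable def scaleZ (M : MACData E) (z : ℝ) (n : ℤ) : Matrix E E ℝ :=
  z ^ (-n) • (1 + M.sumW z n * (1 - M.F z))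

theorem scaleZ_of_le_one (M : MACData E) (z : ℝ) {n : ℤ} (hn : n ≤ 1) :
    M.scaleZ z n = z ^ (-n) • 1 := by
  simp [scaleZ, M.sumW_of_le_one z hn]

theorem scaleZ_succ (M : MACData E) {z : ℝ} (hz : 0 < z) (n : ℤ) :
    M.scaleZ z (n + 1) = z⁻¹ • (M.scaleZ z n + M.scaleW n * (1 - M.F z)) := by
  have h1 : z ^ (-(n + 1)) = z⁻¹ * z ^ (-n) := by
    rw [neg_add, zpow_add₀ hz.ne', mul_comm, zpow_neg_one]
  have h2 : z ^ (-n) * z ^ n = 1 := by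
    rw [← zpow_add₀ hz.ne']
    simp
  rw [scaleZ, scaleZ, sumW_succ, h1, mul_smul, add_mul, ← add_assoc, smul_add (z ^ (-n)),
    smul_mul_assoc, smul_smul (z ^ (-n)), h2, one_smul]

/-- With T the partial sum of W in Z(z, n), the claim is F + (T + I)(I - F) = I + T(I - F): the unit
source, present for n ≥ 1, cancels F. -/
theorem hasSum_scaleZ (M : MACData E) (hA : IsUnit (M.A 1)) {z : ℝ} (hz : z ∈ Set.Ioc (0 : ℝ) 1)
    {n : ℤ} (hn : 1 ≤ n) : HasSum (fun m => M.A m * M.scaleZ z (n + m)) (M.scaleZ z n) := by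
  obtain ⟨n, rfl⟩ := Int.eq_ofNat_of_zero_le (by omega : 0 ≤ n)
  have h := ((M.hasSum_F hz).add ((M.hasSum_sumW hA hz.1 n).mul_right (1 - M.F z))).const_smul
    (z ^ (-(n : ℤ)))
  have hn0 : n ≠ 0 := by omega
  refine Eq.subst (motive := fun c => HasSum _ c) ?_ (h.congr_fun fun m => ?_)
  swap
  · have h1 : z ^ (-((n : ℤ) + m)) = z ^ (-(n : ℤ)) * z ^ (-m) := by
      rw [neg_add, zpow_add₀ hz.1.ne']
    rw [scaleZ, h1, mul_smul, mul_smul_comm, smul_add, mul_add, mul_smul_comm, mul_one,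
      mul_assoc, smul_mul_assoc]
  · rw [scaleZ, if_neg hn0, add_mul, one_mul]
    congr 1
    abel

theorem IsMAC.Z_eq {M : MACData E} (hA : IsUnit (M.A 1)) {Ω : Type*} [MeasurableSpace Ω]
    {S : ℕ → Ω → Option (ℤ × E)} {ℙ : ℤ × E → Measure Ω} (hS : M.IsMAC S ℙ) (z : ℝ) (n : ℕ) :
    MAC.Z S ℙ M z n = M.scaleZ z n := by
  simp only [Z, scaleZ, sumW, hS.W_eq hA, Int.toNat_natCast, Finset.sum_mul, smul_mul_assoc,
    zpow_neg, zpow_natCast, inv_pow]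

end MACData

/-! ### Restarting the reflection, and the exit functional -/

namespace MAC

section Regulators

variable (d : ℕ) (ξ : ℕ → ℤ)

/-- Reflection uses only the increments after its starting value, so the path after time 1 can be
translated to start at the clipped level. The regulators restart likewise, which yields the
recursion in the first step. -/
theorem reflected_succ_eq (n : ℕ) : reflected d ξ (n + 1) =
    reflected d (fun k => ξ (k + 1) + (max (-(d : ℤ)) (min 0 (ξ 1)) - ξ 1)) n := by
  induction n with
  | zero => simp [reflected]
  | succ n ih =>
    rw [reflected, ih, reflected]
    congr 3
    ring

theorem lowerReg_succ_eq (n : ℕ) : lowerReg d ξ (n + 1) = max 0 (-(d : ℤ) - ξ 1) +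
    lowerReg d (fun k => ξ (k + 1) + (max (-(d : ℤ)) (min 0 (ξ 1)) - ξ 1)) n := by
  induction n with
  | zero => simp [lowerReg, reflected]
  | succ n ih =>
    rw [lowerReg, ih, lowerReg, reflected_succ_eq, add_assoc]
    congr 4
    ring

theorem upperReg_succ_eq (n : ℕ) : upperReg d ξ (n + 1) = max 0 (ξ 1) +
    upperReg d (fun k => ξ (k + 1) + (max (-(d : ℤ)) (min 0 (ξ 1)) - ξ 1)) n := by
  induction n with
  | zero => simp [upperReg, reflected]
  | succ n ih =>
    rw [upperReg, ih, upperReg, reflected_succ_eq, add_assoc]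
    congr 4
    ring

theorem lowerReg_nonneg (n : ℕ) : 0 ≤ lowerReg d ξ n := by
  induction n with
  | zero => exact le_rfl
  | succ n ih => exact add_nonneg ih (le_max_left _ _)

theorem upperReg_nonneg (n : ℕ) : 0 ≤ upperReg d ξ n := by
  induction n with
  | zero => exact le_rfl
  | succ n ih => exact add_nonneg ih (le_max_left _ _)

variable {d ξ} {ζ : ℕ → ℤ} {n : ℕ}

theorem reflected_congr (h : ∀ k ≤ n, ξ k = ζ k) : reflected d ξ n = reflected d ζ n := by
  induction n with
  | zero => exact h 0 le_rfl
  | succ n ih =>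
    rw [reflected, reflected, ih fun k hk => h k (by omega), h n (by omega), h (n + 1) le_rfl]

theorem lowerReg_congr (h : ∀ k ≤ n, ξ k = ζ k) : lowerReg d ξ n = lowerReg d ζ n := by
  induction n with
  | zero => rfl
  | succ n ih =>
    rw [lowerReg, lowerReg, ih fun k hk => h k (by omega), h n (by omega), h (n + 1) le_rfl,
      reflected_congr fun k hk => h k (by omega)]

theorem upperReg_congr (h : ∀ k ≤ n, ξ k = ζ k) : upperReg d ξ n = upperReg d ζ n := by
  induction n with
  | zero => rfl
  | succ n ih =>
    rw [upperReg, upperReg, ih fun k hk => h k (by omega), h n (by omega), h (n + 1) le_rfl,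
      reflected_congr fun k hk => h k (by omega)]

end Regulators

variable {E : Type*}

open Classical in
/-- The contribution of `{ρ₀ = n, J_n = j}` to `z ^ R⁻`, for the path `p` with its level shifted
by `c`. -/
noncomputable def exitFun (d : ℕ) (z : ℝ) (n : ℕ) (c : ℤ) (j : E) (p : ℕ → Option (ℤ × E)) :
    ℝ≥0∞ :=
  if (0 < upperReg d (fun k => level (p k) + c) n ∧
      ∀ k < n, ¬ 0 < upperReg d (fun k => level (p k) + c) k) ∧ (p n).map Prod.snd = some j then
    ENNReal.ofReal (z ^ lowerReg d (fun k => level (p k) + c) n)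
  else 0

open Classical in
theorem measurable_exitFun [Finite E] (d : ℕ) (z : ℝ) (n : ℕ) (c : ℤ) (j : E) :
    Measurable (exitFun d z n c j) := by
  refine measurable_of_agree n fun p q h => ?_
  have h' : ∀ k ≤ n, level (p k) + c = level (q k) + c := fun k hk => by rw [h k hk]
  have h1 : (∀ k < n, ¬ 0 < upperReg d (fun k => level (p k) + c) k) ↔
      ∀ k < n, ¬ 0 < upperReg d (fun k => level (q k) + c) k :=
    forall_congr' fun k => forall_congr' fun hk => by
      rw [upperReg_congr fun l hl => h' l (hl.trans hk.le)]
  rw [exitFun, exitFun, upperReg_congr h', lowerReg_congr h', h n le_rfl]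
  exact if_congr (and_congr_left' (and_congr_right' h1)) rfl rfl

theorem exitFun_cons_of_pos [DecidableEq E] {d : ℕ} {z : ℝ} {n : ℕ} {c : ℤ} {j : E} {a : Option (ℤ × E)}
    {p : ℕ → Option (ℤ × E)} {b : ℤ × E} (hp : p 0 = some b) (h : 0 < b.1 + c) :
    exitFun d z (n + 1) c j (cons a p) = if n = 0 ∧ b.2 = j then 1 else 0 := by
  have hl : level (p 0) = b.1 := by rw [hp]; rfl
  have h1 : ∀ n, 0 < upperReg d (fun k => level (cons a p k) + c) (n + 1) := fun n => by
    rw [upperReg_succ_eq]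
    refine add_pos_of_pos_of_nonneg (lt_max_of_lt_right ?_) (upperReg_nonneg _ _ _)
    simpa [hl] using h
  rw [exitFun]
  rcases n with _ | n
  · have h2 : lowerReg d (fun k => level (cons a p k) + c) (0 + 1) = 0 := by
      rw [lowerReg_succ_eq]
      simp only [lowerReg, add_zero, cons_succ, hl]
      omega
    have h3 : ∀ k < 0 + 1, ¬ 0 < upperReg d (fun k => level (cons a p k) + c) k := fun k hk => by
      obtain rfl : k = 0 := by omega
      exact lt_irrefl _
    rw [h2]
    by_cases hj : b.2 = j
    · rw [if_pos ⟨⟨h1 0, h3⟩, by simp [hp, hj]⟩, if_pos ⟨rfl, hj⟩]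
      simp
    · rw [if_neg fun h => hj (by simpa [hp] using h.2), if_neg fun h => hj h.2]
  · have h2 : ¬ ∀ k < n + 1 + 1, ¬ 0 < upperReg d (fun k => level (cons a p k) + c) k :=
      fun h => h 1 (by omega) (h1 0)
    rw [if_neg fun h => h2 h.1.2, if_neg fun h => Nat.succ_ne_zero n h.1]

open Classical in
theorem exitFun_cons_of_nonpos {d : ℕ} {z : ℝ} (hz : 0 < z) {n : ℕ} {c : ℤ} {j : E}
    {a : Option (ℤ × E)} {p : ℕ → Option (ℤ × E)} {b : ℤ × E} (hp : p 0 = some b)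
    (h : b.1 + c ≤ 0) :
    exitFun d z (n + 1) c j (cons a p) = ENNReal.ofReal z ^ (-(d : ℤ) - (b.1 + c)).toNat *
      exitFun d z n (c + (max (-(d : ℤ)) (b.1 + c) - (b.1 + c))) j p := by
  have hl : level (p 0) = b.1 := by rw [hp]; rfl
  have hmin : min 0 (b.1 + c) = b.1 + c := min_eq_right h
  have h1 : ∀ n, upperReg d (fun k => level (cons a p k) + c) (n + 1) = upperReg d
      (fun k => level (p k) + (c + (max (-(d : ℤ)) (b.1 + c) - (b.1 + c)))) n := fun n => by
    rw [upperReg_succ_eq]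
    have : cons a p 1 = p 0 := rfl
    simp only [this, hl, hmin, max_eq_left h, zero_add, cons_succ, add_assoc]
  have h2 : lowerReg d (fun k => level (cons a p k) + c) (n + 1) =
      ((-(d : ℤ) - (b.1 + c)).toNat : ℤ) + lowerReg d
      (fun k => level (p k) + (c + (max (-(d : ℤ)) (b.1 + c) - (b.1 + c)))) n := by
    rw [lowerReg_succ_eq]
    have : cons a p 1 = p 0 := rfl
    simp only [this, hl, hmin, cons_succ, add_assoc, Int.toNat_eq_max]
    rw [max_comm]
  have h3 : (∀ k < n + 1, ¬ 0 < upperReg d (fun k => level (cons a p k) + c) k) ↔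
      ∀ k < n, ¬ 0 < upperReg d
        (fun k => level (p k) + (c + (max (-(d : ℤ)) (b.1 + c) - (b.1 + c)))) k := by
    constructor
    · intro H k hk
      rw [← h1]
      exact H (k + 1) (by omega)
    · intro H k hk
      cases k with
      | zero => exact lt_irrefl _
      | succ k =>
        rw [h1]
        exact H k (by omega)
  rw [exitFun, exitFun, h1, h2, mul_ite, mul_zero, zpow_add₀ hz.ne', zpow_natCast,
    ENNReal.ofReal_mul (pow_nonneg hz.le _), ENNReal.ofReal_pow hz.le]
  exact if_congr (and_congr_left' (and_congr_right' h3)) rfl rfl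

open Classical in
theorem tsum_exitFun {Ω : Type*} (S : ℕ → Ω → Option (ℤ × E)) (d : ℕ) (z : ℝ) (j : E) (ω : Ω) :
    ∑' n, exitFun d z n 0 j (fun n => S n ω) =
      if rho S d ω ≠ ⊤ ∧ (S (rho S d ω).toNat ω).map Prod.snd = some j then
        ENNReal.ofReal (z ^ lowerReg d (fun k => level (S k ω)) (rho S d ω).toNat) else 0 := by
  have key : ∀ n, exitFun d z n 0 j (fun n => S n ω) =
      if rho S d ω = n ∧ (S n ω).map Prod.snd = some j then
        ENNReal.ofReal (z ^ lowerReg d (fun k => level (S k ω)) n) else 0 := by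
    intro n
    rw [exitFun, rho]
    simp only [add_zero, firstTime_eq_coe]
  simp only [key]
  by_cases h : rho S d ω = ⊤
  · simp [h]
  · obtain ⟨n, hn⟩ := ENat.ne_top_iff_exists.1 h
    rw [tsum_eq_single n fun m hm => ?_]
    · simp [← hn]
    · rw [if_neg]
      rintro ⟨h1, -⟩
      rw [← hn, Nat.cast_inj] at h1
      exact hm h1.symm

end MAC

namespace MACData

open MAC

variable {E : Type*} [Fintype E] [DecidableEq E]

/-- The contribution of `{ρ₀ = n}` to the transform of the lower regulator at `ρ₀`, for the
reflected process started at `h`. -/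
noncomputable def exitAt (M : MACData E) (d : ℕ) (z : ℝ) : ℕ → ℤ → Matrix E E ℝ≥0∞
  | 0, _ => 0
  | n + 1, h => M.transfer (fun y => if 0 < y then (if n = 0 then 1 else 0) else
      ENNReal.ofReal z ^ (-(d : ℤ) - y).toNat • M.exitAt d z n (max (-(d : ℤ)) y)) h

/-- The transform of the lower regulator at `ρ₀`, for the reflected process started at `h`. -/
noncomputable def exitTotal (M : MACData E) (d : ℕ) (z : ℝ) (h : ℤ) : Matrix E E ℝ≥0∞ :=
  Matrix.of fun i j => ∑' n, M.exitAt d z n h i j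

theorem exitTotal_eq (M : MACData E) (d : ℕ) (z : ℝ) (h : ℤ) :
    M.exitTotal d z h = M.transfer (fun y => if 0 < y then 1 else
      ENNReal.ofReal z ^ (-(d : ℤ) - y).toNat • M.exitTotal d z (max (-(d : ℤ)) y)) h := by
  ext i j
  simp only [exitTotal, Matrix.of_apply]
  rw [tsum_eq_zero_add' ENNReal.summable]
  simp only [exitAt, Matrix.zero_apply, zero_add]
  rw [← transfer_tsum]
  -- A step above 0 ends at time 1 and contributes once; a step to y ≤ 0 contributes the push
  -- z^{-d-y} (if y < -d) and a restart at max(-d, y).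
  refine congrFun (congrFun (M.transfer_congr fun m _ => ?_) i) j
  ext k l
  rw [Matrix.of_apply]
  split_ifs with h
  · rw [tsum_eq_single 0 fun n hn => by simp [hn]]
    simp
  · simp only [Matrix.smul_apply, smul_eq_mul, Matrix.of_apply, ENNReal.tsum_mul_left]

namespace IsMAC

variable {M : MACData E} {Ω : Type*} [MeasurableSpace Ω]
  {S : ℕ → Ω → Option (ℤ × E)} {ℙ : ℤ × E → Measure Ω}

theorem lintegral_exitFun (hS : M.IsMAC S ℙ) (d : ℕ) {z : ℝ} (hz : 0 < z) (n : ℕ) (c x : ℤ)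
    (i j : E) :
    ∫⁻ ω, exitFun d z n c j (fun n => S n ω) ∂ℙ (x, i) = M.exitAt d z n (x + c) i j := by
  induction n generalizing c x i with
  | zero => simp [exitFun, upperReg, exitAt]
  | succ n ih =>
    rw [hS.lintegral_firstStep x i (measurable_exitFun d z (n + 1) c j)
      (by rw [exitFun, if_neg]; simp), exitAt]
    refine tsum_congr fun m => Finset.sum_congr rfl fun k _ => ?_
    congr 1
    have hxc : x + c + m = x + m + c := by ring
    rw [hxc]
    beta_reduce
    by_cases h : 0 < x + m + c
    · rw [if_pos h]
      have hae : ∀ᵐ ω ∂ℙ (x + m, k), exitFun d z (n + 1) c j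
          (cons (some (x, i)) fun n => S n ω) = if n = 0 ∧ k = j then 1 else 0 := by
        filter_upwards [hS.ae_start (x + m, k)] with ω hω
        exact exitFun_cons_of_pos (b := (x + m, k)) (c := c) (p := fun n => S n ω) hω h
      have := hS.prob (x + m, k)
      rw [lintegral_congr_ae hae, lintegral_const, measure_univ, mul_one]
      by_cases hn : n = 0 <;> simp [hn, Matrix.one_apply]
    · rw [if_neg h]
      have hae : ∀ᵐ ω ∂ℙ (x + m, k), exitFun d z (n + 1) c j
          (cons (some (x, i)) fun n => S n ω) =
          ENNReal.ofReal z ^ (-(d : ℤ) - (x + m + c)).toNat *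
          exitFun d z n (c + (max (-(d : ℤ)) (x + m + c) - (x + m + c))) j fun n => S n ω := by
        filter_upwards [hS.ae_start (x + m, k)] with ω hω
        exact exitFun_cons_of_nonpos (b := (x + m, k)) (c := c) (p := fun n => S n ω) hz hω
          (not_lt.1 h)
      rw [lintegral_congr_ae hae, lintegral_const_mul' _ _ (ENNReal.pow_ne_top
        ENNReal.ofReal_ne_top), ih, Matrix.smul_apply, smul_eq_mul]
      congr 3
      ring

theorem lintegral_tsum_exitFun (hS : M.IsMAC S ℙ) (d : ℕ) {z : ℝ} (hz : 0 < z) (x : ℤ)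
    (i j : E) :
    ∫⁻ ω, ∑' n, exitFun d z n 0 j (fun n => S n ω) ∂ℙ (x, i) = M.exitTotal d z x i j := by
  refine (lintegral_tsum fun n =>
    ((measurable_exitFun d z n 0 j).comp hS.measurable_path).aemeasurable).trans ?_
  refine tsum_congr fun n => ?_
  simpa using hS.lintegral_exitFun d hz n 0 x i j

theorem exitTotal_ne_top (hS : M.IsMAC S ℙ) (d : ℕ) {z : ℝ} (hz : z ∈ Set.Ioc (0 : ℝ) 1) (x : ℤ)
    (i j : E) : M.exitTotal d z x i j ≠ ⊤ := by
  classical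
  have := hS.prob (x, i)
  rw [← hS.lintegral_tsum_exitFun d hz.1]
  refine ne_top_of_le_ne_top ENNReal.one_ne_top
    -- At most one time n contributes, with z^{R⁻} ≤ 1 because z ≤ 1 and R⁻ ≥ 0.
    ((lintegral_mono (g := fun _ => 1) fun ω => ?_).trans_eq (by simp))
  beta_reduce
  rw [tsum_exitFun]
  split_ifs
  · rw [ENNReal.ofReal_le_one]
    exact zpow_le_one₀ hz.1 hz.2 (lowerReg_nonneg _ _ _)
  · exact zero_le_one

theorem lowerRegTransform_eq (hS : M.IsMAC S ℙ) (d : ℕ) {z : ℝ} (hz : z ∈ Set.Ioc (0 : ℝ) 1)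
    (x : ℤ) : lowerRegTransform S ℙ d z x = (M.exitTotal d z x).map ENNReal.toReal := by
  classical
  ext i j
  rw [Matrix.map_apply, ← hS.lintegral_tsum_exitFun d hz.1, lowerRegTransform, Matrix.of_apply]
  have hmeas : Measurable fun ω => ∑' n, exitFun d z n 0 j (fun n => S n ω) :=
    Measurable.tsum fun n => (measurable_exitFun d z n 0 j).comp hS.measurable_path
  have hpos : ∀ k : ℤ, 0 < z ^ k := fun k => zpow_pos hz.1 k
  have hset : MeasurableSet {ω | rho S d ω ≠ ⊤ ∧
      (S (rho S d ω).toNat ω).map Prod.snd = some j} := by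
    -- Powers of z are positive, so the event is exactly where the measurable sum over n is nonzero.
    convert hmeas (measurableSet_singleton 0).compl using 1
    ext ω
    simp only [Set.mem_preimage, tsum_exitFun, Set.mem_compl_iff, Set.mem_singleton_iff,
      ite_eq_right_iff, ENNReal.ofReal_eq_zero, not_le.2 (hpos _), imp_false, not_not]
    rfl
  rw [← integral_indicator hset, ← integral_toReal hmeas.aemeasurable]
  · refine integral_congr_ae (Filter.Eventually.of_forall fun ω => ?_)
    beta_reduce
    rw [tsum_exitFun, Set.indicator_apply]
    simp only [Set.mem_ofPred_eq]
    split_ifs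
    · exact (ENNReal.toReal_ofReal (hpos _).le).symm
    · rfl
  · refine Filter.Eventually.of_forall fun ω => ?_
    rw [tsum_exitFun]
    split_ifs <;> simp

end IsMAC

/-! ### Uniqueness in the strip and the exit identity -/

omit [DecidableEq E] in
/-- Uniqueness for the Dirichlet problem in the strip `[-d, 0]`, with reflection at `-d`. -/
theorem eq_zero_of_harmonic (M : MACData E) {α : ℝ} (hα0 : 0 < α)
    (hα : ∀ i, α ≤ ∑ k, M.A 1 i k) (d : ℕ) {z : ℝ} (hz : z ∈ Set.Ioc (0 : ℝ) 1)
    {f : ℤ → Matrix E E ℝ} (h1 : f 1 = 0)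
    (hrefl : ∀ y ≤ -(d : ℤ), f y = z ^ (-(d : ℤ) - y).toNat • f (-d))
    (hharm : ∀ x ∈ Set.Icc (-(d : ℤ)) 0, HasSum (fun m => M.A m * f (x + m)) (f x)) :
    ∀ x ∈ Set.Icc (-(d : ℤ)) 0, f x = 0 := by
  obtain hE | hE := isEmpty_or_nonempty E
  · intro x _
    ext i
    exact isEmptyElim i
  obtain ⟨⟨x₀, i₀, j₀⟩, h₀, hmax⟩ := Finset.exists_max_image
    (Finset.Icc (-(d : ℤ)) 0 ×ˢ (Finset.univ : Finset (E × E))) (fun q => |f q.1 q.2.1 q.2.2|)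
    ⟨(0, hE.some, hE.some), by simp⟩
  set C := |f x₀ i₀ j₀| with hC
  have hC0 : 0 ≤ C := abs_nonneg _
  have hle : ∀ x ∈ Set.Icc (-(d : ℤ)) 0, ∀ i j, |f x i j| ≤ C := fun x hx i j =>
    hmax (x, i, j) (by simpa using hx)
  have hle1 : ∀ y ≤ 1, ∀ i j, |f y i j| ≤ C := by
    intro y hy i j
    rcases lt_or_ge y (-(d : ℤ)) with h | h
    · rw [hrefl y h.le, Matrix.smul_apply, smul_eq_mul, abs_mul, abs_of_nonneg
        (pow_nonneg hz.1.le _)]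
      exact (mul_le_of_le_one_left (abs_nonneg _) (pow_le_one₀ hz.1.le hz.2)).trans
        (hle _ ⟨le_rfl, by omega⟩ i j)
    · rcases eq_or_ne y 1 with rfl | hy1
      · simpa [h1] using hC0
      · exact hle y ⟨h, by omega⟩ i j
  -- Level 1 - n reaches the zero boundary value at level 1 in n upward steps, of probability at
  -- least α^n; all other paths contribute at most C. At a maximum point this reads C ≤ C(1 - α^n),
  -- so C = 0.
  have claim : ∀ n : ℕ, n ≤ d + 1 → ∀ i j, |f (1 - n) i j| ≤ C * (1 - α ^ n) := by
    intro n
    induction n with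
    | zero => simp [h1]
    | succ n ih =>
      intro hn i j
      have hx : (1 - ((n + 1 : ℕ) : ℤ)) ∈ Set.Icc (-(d : ℤ)) 0 := by
        constructor <;> push_cast <;> omega
      have hs := Pi.hasSum.1 (Pi.hasSum.1 (hharm _ hx) i) j
      have hg : HasSum (fun m => C * ∑ k, M.A m i k -
          if m = 1 then C * α ^ n * ∑ k, M.A 1 i k else 0)
          (C * (1 - M.kill) - C * α ^ n * ∑ k, M.A 1 i k) := by
        refine HasSum.sub (HasSum.mul_left C ?_) (hasSum_ite_eq 1 _)
        rw [← M.rowSum i]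
        exact hasSum_sum fun k _ => (M.summable i k).hasSum
      refine (hs.norm_le_of_bounded hg fun m => ?_).trans ?_
      · rw [Matrix.mul_apply]
        refine (norm_sum_le _ _).trans ?_
        simp only [norm_mul, Real.norm_eq_abs, abs_of_nonneg (M.nonneg _ _ _)]
        rcases lt_trichotomy m 1 with hm | rfl | hm
        · rw [if_neg hm.ne, sub_zero, Finset.mul_sum]
          refine Finset.sum_le_sum fun k _ => ?_
          rw [mul_comm]
          exact mul_le_mul_of_nonneg_right (hle1 _ (by push_cast; omega) k j) (M.nonneg _ _ _)
        · rw [if_pos rfl, ← sub_mul, Finset.mul_sum]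
          refine Finset.sum_le_sum fun k _ => ?_
          rw [mul_comm]
          refine mul_le_mul_of_nonneg_right ?_ (M.nonneg _ _ _)
          have := ih (by omega) k j
          have e : (1 - ((n + 1 : ℕ) : ℤ)) + 1 = 1 - n := by push_cast; ring
          rw [e]
          linarith
        · simp [M.skipFree m hm, hm.ne']
      · have h2 : C * α ^ n * α ≤ C * α ^ n * ∑ k, M.A 1 i k :=
          mul_le_mul_of_nonneg_left (hα i) (by positivity)
        have h3 : C * (1 - M.kill) ≤ C * 1 :=
          mul_le_mul_of_nonneg_left (by linarith [M.kill_nonneg]) hC0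
        rw [pow_succ]
        linarith
  have hx₀ : -(d : ℤ) ≤ x₀ ∧ x₀ ≤ 0 := by simpa using h₀
  have h2 := claim (1 - x₀).toNat (by omega) i₀ j₀
  have e : (1 - (((1 - x₀).toNat : ℕ) : ℤ)) = x₀ := by omega
  rw [e, ← hC] at h2
  have h3 : 0 < α ^ (1 - x₀).toNat := by positivity
  have hC1 : C = 0 := by
    refine le_antisymm ?_ hC0
    by_contra hlt
    have := mul_pos (not_le.1 hlt) h3
    linarith
  intro x hx
  ext i j
  exact abs_eq_zero.1 (le_antisymm ((hle x hx i j).trans_eq hC1) (abs_nonneg _))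

theorem scaleZ_reflect (M : MACData E) (d : ℕ) {z : ℝ} (hz : 0 < z) {y : ℤ}
    (hy : y ≤ -(d : ℤ)) : M.scaleZ z (d + 1 + y) =
      z ^ (-(d : ℤ) - y).toNat • M.scaleZ z (d + 1 + -(d : ℤ)) := by
  rw [M.scaleZ_of_le_one z (by omega), M.scaleZ_of_le_one z (by omega), smul_smul, ← zpow_natCast,
    Int.toNat_of_nonneg (by omega), ← zpow_add₀ hz.ne']
  congr 2
  ring

theorem isUnit_scaleZ (M : MACData E) (hA : IsUnit (M.A 1)) (d : ℕ) {z : ℝ}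
    (hz : z ∈ Set.Ioc (0 : ℝ) 1) : IsUnit (M.scaleZ z (d + 2)) := by
  obtain ⟨α, hα0, -, hα⟩ := M.exists_le_sum_A_one hA
  refine Matrix.isUnit_of_mul_eq_zero fun B hB => ?_
  have h := M.eq_zero_of_harmonic hα0 hα d hz (f := fun y => M.scaleZ z (d + 1 + y) * B)
    (by rw [add_assoc]; exact hB)
    (fun y hy => by rw [M.scaleZ_reflect d hz.1 hy, smul_mul_assoc])
    (fun x hx => by
      refine ((M.hasSum_scaleZ hA hz (n := d + 1 + x) (by linarith [hx.1])).mul_right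
        B).congr_fun fun m => ?_
      rw [mul_assoc, ← add_assoc])
    (-d) ⟨le_rfl, by omega⟩
  have e : (d : ℤ) + 1 + -d = 1 := by ring
  simp only [e, M.scaleZ_of_le_one z le_rfl, smul_mul_assoc, one_mul] at h
  exact (smul_eq_zero.1 h).resolve_left (zpow_ne_zero _ hz.1.ne')

theorem IsMAC.lowerRegTransform_eq_scaleZ {M : MACData E} (hA : IsUnit (M.A 1)) {Ω : Type*}
    [MeasurableSpace Ω] {S : ℕ → Ω → Option (ℤ × E)} {ℙ : ℤ × E → Measure Ω} (hS : M.IsMAC S ℙ)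
    (d : ℕ) {z : ℝ} (hz : z ∈ Set.Ioc (0 : ℝ) 1) {x : ℤ} (hx : x ∈ Set.Icc (-(d : ℤ)) 0) :
    lowerRegTransform S ℙ d z x = M.scaleZ z (d + 1 + x) * (M.scaleZ z (d + 2))⁻¹ := by
  obtain ⟨α, hα0, -, hα⟩ := M.exists_le_sum_A_one hA
  have hunit := (Matrix.isUnit_iff_isUnit_det _).1 (M.isUnit_scaleZ hA d hz)
  -- The transform is extended to all levels: I above the strip, the reflection rule below it, so
  -- that its first step equation becomes plain harmonicity on the strip.
  let û : ℤ → Matrix E E ℝ≥0∞ := fun y => if 0 < y then 1 else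
      ENNReal.ofReal z ^ (-(d : ℤ) - y).toNat • M.exitTotal d z (max (-(d : ℤ)) y)
  have hû : ∀ y i j, û y i j ≠ ⊤ := by
    intro y i j
    simp only [û]
    split_ifs
    · rw [Matrix.one_apply]
      split_ifs <;> simp
    · exact ENNReal.mul_ne_top (ENNReal.pow_ne_top ENNReal.ofReal_ne_top)
        (hS.exitTotal_ne_top d hz _ i j)
  have hstrip : ∀ y ∈ Set.Icc (-(d : ℤ)) 0, û y = M.exitTotal d z y := by
    intro y hy
    have e : (-(d : ℤ) - y).toNat = 0 := by have := hy.1; omega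
    simp only [û, if_neg (not_lt.2 hy.2), e, pow_zero, one_smul, max_eq_right hy.1]
  have hu1 : (û 1).map ENNReal.toReal = 1 := by
    simp only [û, zero_lt_one, if_true, Matrix.map_toReal_one]
  have h := M.eq_zero_of_harmonic hα0 hα d hz
    (f := fun y => (û y).map ENNReal.toReal - M.scaleZ z (d + 1 + y) * (M.scaleZ z (d + 2))⁻¹)
    (by
      have e : (d : ℤ) + 1 + 1 = d + 2 := by ring
      simp only [hu1, e, Matrix.mul_nonsing_inv _ hunit, sub_self])
    (fun y hy => by
      rw [M.scaleZ_reflect d hz.1 hy, smul_sub, smul_mul_assoc, hstrip _ ⟨le_rfl, by omega⟩]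
      congr 1
      have h0 : ¬ 0 < y := by omega
      ext i j
      simp only [û, if_neg h0, max_eq_left hy, Matrix.map_apply, Matrix.smul_apply, smul_eq_mul,
        ENNReal.toReal_mul, ENNReal.toReal_pow, ENNReal.toReal_ofReal hz.1.le])
    (fun y hy => by
      have e1 : û y = M.transfer û y := (hstrip y hy).trans (M.exitTotal_eq d z y)
      have e2 := M.hasSum_transfer (f := û) (x := y) (fun m _ => hû _)
        (by rw [← e1]; exact hû y)
      rw [← e1] at e2
      refine (e2.sub ((M.hasSum_scaleZ hA hz (n := d + 1 + y) (by linarith [hy.1])).mul_right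
        (M.scaleZ z (d + 2))⁻¹)).congr_fun fun m => ?_
      rw [mul_sub, mul_assoc, ← add_assoc])
    x hx
  rw [hS.lowerRegTransform_eq d hz, ← hstrip x hx]
  exact sub_eq_zero.1 h

end MACData

theorem mainTheorem2 {E : Type*} [Fintype E] [DecidableEq E] [Nonempty E]
    (M : MACData E) (hA : IsUnit (M.A 1))
    {Ω : Type*} [MeasurableSpace Ω] (S : ℕ → Ω → Option (ℤ × E)) (ℙ : ℤ × E → Measure Ω)
    (hS : M.IsMAC S ℙ) (d : ℕ) (hd : 0 < d)
    (z : ℝ) (hz : z ∈ Set.Ioc (0 : ℝ) 1) (x : ℤ) (hx : x ∈ Set.Icc (-(d : ℤ)) 0) :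
    IsUnit (MAC.Z S ℙ M z (d + 1)) ∧
    IsUnit (1 + MAC.W S ℙ (d + 1) * (1 - M.F z) * (MAC.Z S ℙ M z (d + 1))⁻¹) ∧
    MAC.lowerRegTransform S ℙ d z 0 =
      z • (1 + MAC.W S ℙ (d + 1) * (1 - M.F z) * (MAC.Z S ℙ M z (d + 1))⁻¹)⁻¹ ∧
    MAC.lowerRegTransform S ℙ d z x =
      MAC.Z S ℙ M z ((d : ℤ) + 1 + x).toNat * (MAC.Z S ℙ M z (d + 1))⁻¹ *
        MAC.lowerRegTransform S ℙ d z 0 := by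
  have hZ := hS.Z_eq hA z
  have hd1 : ((d + 1 : ℕ) : ℤ) = d + 1 := by push_cast; ring
  rw [hS.W_eq hA, hZ, hZ, hS.lowerRegTransform_eq_scaleZ hA d hz hx,
    hS.lowerRegTransform_eq_scaleZ hA d hz ⟨by omega, le_rfl⟩,
    Int.toNat_of_nonneg (by linarith [hx.1]), hd1, add_zero]
  -- Z(z, d+1) plays the role of Z(z, d+2) for the strip of width d - 1.
  have hQ : IsUnit (M.scaleZ z (d + 1)) := by
    have h := M.isUnit_scaleZ hA (d - 1) hz
    have e : ((d - 1 : ℕ) : ℤ) + 2 = d + 1 := by omega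
    rwa [e] at h
  have hR := M.isUnit_scaleZ hA d hz
  have hQd := (Matrix.isUnit_iff_isUnit_det _).1 hQ
  have hRd := (Matrix.isUnit_iff_isUnit_det _).1 hR
  have hRQ : M.scaleZ z (d + 2) =
      z⁻¹ • (M.scaleZ z (d + 1) + M.scaleW (d + 1) * (1 - M.F z)) := by
    rw [← M.scaleZ_succ hz.1]
    congr 1
  -- By the recursion for Z, the matrix to invert is z Z(z, d+2) Z(z, d+1)^{-1}, whose inverse is
  -- z^{-1} times the transform at 0.
  have hK : 1 + M.scaleW (d + 1) * (1 - M.F z) * (M.scaleZ z (d + 1))⁻¹ =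
      z • (M.scaleZ z (d + 2) * (M.scaleZ z (d + 1))⁻¹) := by
    rw [hRQ, smul_mul_assoc, smul_smul, mul_inv_cancel₀ hz.1.ne', one_smul, add_mul,
      Matrix.mul_nonsing_inv _ hQd]
  have hKinv : (z • (M.scaleZ z (d + 2) * (M.scaleZ z (d + 1))⁻¹)) *
      (z⁻¹ • (M.scaleZ z (d + 1) * (M.scaleZ z (d + 2))⁻¹)) = 1 := by
    rw [smul_mul_smul_comm, mul_inv_cancel₀ hz.1.ne', one_smul, mul_assoc,
      ← mul_assoc (M.scaleZ z (d + 1))⁻¹, Matrix.nonsing_inv_mul _ hQd, one_mul,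
      Matrix.mul_nonsing_inv _ hRd]
  rw [hK]
  refine ⟨hQ, IsUnit.of_mul_eq_one _ hKinv, ?_, ?_⟩
  · rw [Matrix.inv_eq_right_inv hKinv, smul_smul, mul_inv_cancel₀ hz.1.ne', one_smul]
  · rw [mul_assoc, ← mul_assoc (M.scaleZ z (d + 1))⁻¹, Matrix.nonsing_inv_mul _ hQd, one_mul]
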